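/- **Setting.** Fix an infinite set $X$ of nodes. A literal $a(x_1,\dots,x_k)$ consists of a symbol $a$ and $k=\mathrm{arity}(a)$ pairwise distinct nodes; a graph is a finite sequence of literals, $X(g)$ is the set of nodes occurring in $g$, and $g\bowtie h$ means that $g$ and $h$ are permutations of each other. Let $\Gamma$ be a hyperedge replacement (HR) grammar: finitely many symbols, some of which are terminal, finitely many rules $A\to\varrho$ ($A$ a nonterminal literal, $\varrho$ a graph), and a nonterminal start literal $Z()$ of arity $0$. A derivation step replaces a literal $A^\mu$ of $g$ by $\varrho^\mu$, where $\mu:X\to X$ is injective and maps the nodes of $\varrho$ not in $A$ outside $X(g)$. The language $L(\Gamma)$ consists of all terminal graphs $g$ with $Z()\Rightarrow^*h\bowtie g$ for some $h$; its members are called valid. **dCFA.** Let $\mathit{Start}\to Z()$ be an additional rule. An item $(A\to\alpha\centerdot\beta,\sigma)$ is a rule with a dot in its right-hand side and a partial map $\sigma$ from its nodes to parameters. States are sets of items closed under the following: if $(A\to\alpha\centerdot B\beta,\sigma)$ is in the state and $B'\to\varrho$ is a rule with $B'$, $B$ having the same symbol, then $(B'\to\centerdot\varrho,\sigma')$ is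 in it, where $\sigma'$ assigns to each node of $B'$ the parameter (if any) that $\sigma$ assigns to the corresponding node of $B$ and is undefined elsewhere. The start state $Q_0$ is the closure of $\{(\mathit{Start}\to\centerdot Z(),\iota)\}$ with $\iota$ the empty map. For a pseudo-literal $\ell$ attached to parameters of $Q$ and placeholders –, $Q$ has a transition labelled $\ell$ if some item of $Q$ has the dot in front of a literal $e$ with $\sigma(e)=\ell$ (unassigned nodes become –); the target is the closure of the set of all such items with the dot moved over $e$, the node of $e$ at each placeholder position being assigned a new parameter for that position. States are identified up to renaming of parameters (a representative of each class, and renamings, being chosen arbitrarily). The dCFA states are those reachable from $Q_0$; $Q_A$ is the target of the transition of $Q_0$ for $Z()$. A trigger of $Q$ is a transition with terminal label or a reduce item (dot at the end) of $Q$. It is assumed that each reduce item $(A\to\varrho\centerdot,\sigma)$ in a dCFA state has $\sigma$ defined on all nodes of $A$. **ASR parser.** A configuration $(S,g)$ consists of a stack $S=Q_0^{\iota}e_1Q_1^{\tau_1}\cdots e_nQ_n^{\tau_n}$ of states, with input bindings $\tau_i$ from their parameters to nodes, and literals, and of the graph $g$ processed so far. Let $Q^\tau$ be the top of $S$. A transition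 of $Q$ labelled $\ell$ with terminal symbol causes shift moves $(S,g)\to(SeQ'^{\tau'},ge)$ for literals $e$ with the symbol of $\ell$ whose nodes at parameters $p$ are $\tau(p)$ and whose nodes at placeholders occur neither in $g$ nor on $S$; $Q'$ is its target and $\tau'$ the resulting binding. A reduce item $(A\to\varrho\centerdot,\sigma)$ of $Q$ other than that of $\mathit{Start}\to Z()$ causes the reduce move that pops the literals $\varrho^{\tau\circ\sigma}$ and then pushes $A^{\tau\circ\sigma}$ and the state reached by the corresponding transition of the state now on top (nodes at placeholders do not occur on the remaining stack). A configuration is accepting if $Q=Q_A$. A configuration is reached if it can be obtained from $(Q_0^\iota,\varepsilon)$. **Follow sets.** For a reached $(S,g')$ with top $Q^\tau$ and a trigger $t$ of $Q$, let $\mathit{Success}(S,g',t)$ be the set of graphs $h$ such that some sequence of moves whose first move is caused by $t$ leads from $(S,g')$ to an accepting configuration $(S_A,g'h)$; for the item $(\mathit{Start}\to Z()\centerdot,\iota)$ and $Q=Q_A$ it is $\{\varepsilon\}$. Let $f$ map a node $x$ to a parameter $y$ of $Q$ with $\tau(y)=x$ if there is one, else to – if $x\notin X(g')$, and to $\bullet$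 otherwise. $\mathit{Follow}(Q,t)$ is the set of all $f(\text{first literal of }h)$, and $\mathit{Follow}^*(Q,t)$ the set of all $f(e)$ for literals $e$ of $h$, over all reached $(S,g')$ with top state $Q$ and $h\in\mathit{Success}(S,g',t)$; for $h=\varepsilon$ both get the symbol $\$$. For triggers $t\ne t'$ of $Q$, $t\prec t'$ means $\mathit{Follow}^*(Q,t)\cap\mathit{Follow}(Q,t')\neq\varnothing$. $Q$ is conflict-free if there are no $t_1\prec t_2\prec\dots\prec t_k\prec t_1$. For each dCFA state $Q$ for which this is possible, fix a sequence $t_1,\dots,t_n$ of all its triggers, without repetition, with $\mathit{Follow}(Q,t_i)\cap\mathit{Follow}^*(Q,t_j)=\varnothing$ for $i<j$. **Trigger selection.** A literal $e$ fits a pseudo-literal $\ell$ in $Q^\tau$ if they have the same symbol and, wherever $\ell$ is attached to a parameter $p$ of $Q$, $e$ is attached to $\tau(p)$. $\mathrm{SelectTrigger}(Q,\tau,g'')$ takes the first $t_i$ in the sequence for which some literal $e$ of $g''$ fits some member of $\mathit{Follow}(Q,t_i)$ and returns $(t_i,e)$ for any such $e$; if $g''=\varepsilon$ it returns $(t_i,\$)$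 for the first $t_i$ with $\$\in\mathit{Follow}(Q,t_i)$. If there is no such $t_i$, it fails. **Free edge choice.** $\Gamma$ has the free edge choice property if, for each reached $(S,g')$ with top $Q^\tau$ and each terminal graph $g''\ne\varepsilon$ such that an accepting $(S_A,g'h_0)$ with $h_0\bowtie g''$ can be reached from $(S,g')$, every possible return value $(t,e)$ of $\mathrm{SelectTrigger}(Q,\tau,g'')$ satisfies: (i) $f(e)\in\mathit{Follow}(Q,t)$; (ii) if there are $e',h'$ with $e'h'\bowtie g''$ and moves $(S,g')\xrightarrow{t}(S',g'e')\to^*(S_A,g'e'h')$ with the last configuration accepting, then there is $h$ with $eh\bowtie g''$ and moves $(S,g')\xrightarrow{t}(S',g'e)\to^*(S_A,g'eh)$ with the last configuration accepting. **PSR parser.** A configuration $(S,g,\bar g)$ has in addition a rest graph; it is accepting if $\bar g=\varepsilon$ and $(S,g)$ is accepting. A PSR move $(S,g,\bar g)\to(S',g',\bar g')$ exists if $\mathrm{SelectTrigger}(Q,\tau,\bar g)$, with $Q^\tau$ the top of $S$, may return $(t,e)$ such that $g'=ge$ if $t$ is a transition and $g'=g$ otherwise, $g\bar g\bowtie g'\bar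 g'$, and $(S,g)\xrightarrow{t}(S',g')$ is an ASR move. The parser accepts $g$ if it can reach an accepting configuration from $(Q_0^\iota,\varepsilon,g)$. **Theorem.** Suppose that all dCFA states of $\Gamma$ are conflict-free and that $\Gamma$ has the free edge choice property. Let $g$ be a terminal graph and $(Q_0^\iota,\varepsilon,g)\to^*(S,g',\bar g')$ any sequence of PSR moves. Then the PSR parser can reach an accepting configuration from $(S,g',\bar g')$ if and only if $g\in L(\Gamma)$. In particular, the PSR parser accepts $g$ if and only if $g\in L(\Gamma)$. -/

import Mathlib

namespace HR

/-! ### Graphs, hyperedge replacement grammars and their languages -/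

/-- A literal `a(x₁, …, xₖ)`: a symbol together with `k = arity a` pairwise distinct nodes. -/
structure Lit {Sym : Type} (arity : Sym → ℕ) (X : Type) where
  sym : Sym
  att : Fin (arity sym) ↪ X

/-- A pseudo-literal: a symbol attached to arbitrary objects, repetitions allowed. -/
structure PLit {Sym : Type} (arity : Sym → ℕ) (V : Type) where
  sym : Sym
  att : Fin (arity sym) → V

/-- A graph is a finite sequence of literals. -/
abbrev Graph {Sym : Type} (arity : Sym → ℕ) (X : Type) := List (Lit arity X)

section Literals

variable {Sym : Type} {arity : Sym → ℕ} {X : Type}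

def Lit.nodes (e : Lit arity X) : Set X := Set.range e.att

/-- Apply a node function, giving a pseudo-literal. -/
def Lit.map {V : Type} (e : Lit arity X) (f : X → V) : PLit arity V := ⟨e.sym, f ∘ e.att⟩

/-- Apply a renaming (an injective function on nodes). -/
def Lit.rename (e : Lit arity X) (μ : X ↪ X) : Lit arity X := ⟨e.sym, e.att.trans μ⟩

/-- The set `X(g)` of nodes occurring in `g`. -/
def Graph.nodes (g : Graph arity X) : Set X := {x | ∃ e ∈ g, x ∈ e.nodes}

end Literals

structure Rule {Sym : Type} (arity : Sym → ℕ) (X : Type) where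
  lhs : Lit arity X
  rhs : Graph arity X

/-- A hyperedge replacement grammar over the node supply `X`; `start` is the start literal `Z()`. -/
structure HRGrammar (X : Type) where
  Sym : Type
  finite_sym : Finite Sym
  arity : Sym → ℕ
  terminal : Set Sym
  rules : Set (Rule arity X)
  finite_rules : rules.Finite
  lhs_nonterminal : ∀ r ∈ rules, r.lhs.sym ∉ terminal
  start : Lit arity X
  start_nonterminal : start.sym ∉ terminal
  start_arity : arity start.sym = 0

namespace HRGrammar

variable {X : Type} (Γ : HRGrammar X)

abbrev Literal := Lit Γ.arity X
abbrev Gr := Graph Γ.arity X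

/-- `g` is a graph over the terminal symbols. -/
def IsTerminal (g : Γ.Gr) : Prop := ∀ e ∈ g, e.sym ∈ Γ.terminal

/-- One derivation step: some literal `A^μ` of `g` is replaced by `ϱ^μ`, where the nodes of `ϱ`
that do not occur in `A` are renamed to nodes that do not occur in `g`. -/
def Derives (g h : Γ.Gr) : Prop :=
  ∃ r ∈ Γ.rules, ∃ (μ : X ↪ X) (u v : Γ.Gr),
    g = u ++ r.lhs.rename μ :: v ∧
    h = u ++ r.rhs.map (fun e => e.rename μ) ++ v ∧
    ∀ x ∈ Graph.nodes r.rhs, x ∉ r.lhs.nodes → μ x ∉ Graph.nodes g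

/-- The language: all terminal graphs that are permutations of graphs derivable from `Z()`.
Its members are the valid graphs. -/
def language : Set Γ.Gr :=
  {g | Γ.IsTerminal g ∧ ∃ h, Relation.ReflTransGen Γ.Derives [Γ.start] h ∧ h.Perm g}

/-! ### The characteristic finite automaton -/

/-- An item: a rule (`none` stands for the additional rule `Start → Z`), the position of the dot in
its right-hand side, and the partial assignment of parameters to the nodes of the rule. -/
@[ext] structure Item (P : Type) where
  rule : Option (Rule Γ.arity X)
  dot : ℕ
  bind : X → Option P

variable {Γ}

def Item.rhs {P : Type} (it : Γ.Item P) : Γ.Gr :=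
  match it.rule with
  | none => [Γ.start]
  | some r => r.rhs

/-- The literal right after the dot, if any. -/
def Item.next {P : Type} (it : Γ.Item P) : Option Γ.Literal := it.rhs[it.dot]?

def Item.map {P P' : Type} (f : P → P') (it : Γ.Item P) : Γ.Item P' :=
  ⟨it.rule, it.dot, fun x => (it.bind x).map f⟩

variable (Γ) in
/-- States of characteristic automata are sets of items. -/
abbrev State (P : Type) := Set (Γ.Item P)

/-- The parameters of a state. -/
def params {P : Type} (Q : Γ.State P) : Set P := {p | ∃ it ∈ Q, ∃ x, it.bind x = some p}

/-- The closure of a set of items: if the dot is in front of a nonterminal literal `B`, add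
the items with the dot at the beginning for all rules for the symbol of `B`; the parameters assigned
to nodes of `B` are passed to the corresponding nodes of the left-hand side, and all other nodes
of the rule are still unassigned. -/
inductive Closure {P : Type} (K : Γ.State P) : Γ.State P
  | base (it : Γ.Item P) (h : K it) : Closure K it
  | call (it : Γ.Item P) (h : Closure K it) (B : Γ.Literal) (hB : it.next = some B)
      (r : Rule Γ.arity X) (hr : r ∈ Γ.rules) (β : X → Option P)
      (hpass : r.lhs.map β = B.map it.bind) (hrest : ∀ x ∉ r.lhs.nodes, β x = none) :
      Closure K ⟨some r, 0, β⟩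

/-- `Moves ℓ it it'`: the dot of `it` is in front of a literal `e` whose image under the parameter
assignment (with `none` as the placeholder `–` for unassigned nodes) is `ℓ`, and `it'` results
from moving the dot over `e`. Nodes of `e` that were unassigned get new parameters: the `i`-th
attached node gets the parameter `Sum.inr i`. -/
def Moves {P : Type} (ℓ : PLit Γ.arity (Option P)) (it : Γ.Item P) (it' : Γ.Item (P ⊕ ℕ)) : Prop :=
  ∃ e, it.next = some e ∧ e.map it.bind = ℓ ∧ it'.rule = it.rule ∧ it'.dot = it.dot + 1 ∧
    (∀ x p, it.bind x = some p → it'.bind x = some (Sum.inl p)) ∧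
    (∀ i, it.bind (e.att i) = none → it'.bind (e.att i) = some (Sum.inr (i : ℕ))) ∧
    (∀ x ∉ e.nodes, it.bind x = none → it'.bind x = none)

/-- `Q` has an outgoing transition labelled with the pseudo-literal `ℓ`. -/
def HasTransition {P : Type} (Q : Γ.State P) (ℓ : PLit Γ.arity (Option P)) : Prop :=
  ∃ it ∈ Q, ∃ it', Moves ℓ it it'

/-- The set of items reached from `Q` by the transition labelled `ℓ`, before its parameters are
renamed. -/
def goto {P : Type} (Q : Γ.State P) (ℓ : PLit Γ.arity (Option P)) : Γ.State (P ⊕ ℕ) :=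
  Closure {it' | ∃ it ∈ Q, Moves ℓ it it'}

variable (Γ) in
/-- The states of the deterministic automaton are item sets up to renaming of their parameters.
A naming of parameters chooses one representative of each class, and a renaming of it into
each member of the class. -/
structure Naming where
  rep : Γ.State (ℕ ⊕ ℕ) → Γ.State ℕ
  ren : Γ.State (ℕ ⊕ ℕ) → ℕ ≃ ℕ ⊕ ℕ
  image_rep : ∀ R, Item.map (ren R) '' rep R = R
  rep_eq : ∀ R R' (π : (ℕ ⊕ ℕ) ≃ (ℕ ⊕ ℕ)), Item.map π '' R = R' → rep R = rep R'

theorem Item.map_map {P P' P'' : Type} (f : P → P') (f' : P' → P'') (it : Γ.Item P) :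
    (it.map f).map f' = it.map (f' ∘ f) := by
  simp [Item.map, Function.comp_def]

theorem Item.map_id {P : Type} (it : Γ.Item P) : it.map id = it := by
  simp [Item.map]

theorem exists_rep (R : Γ.State (ℕ ⊕ ℕ)) :
    ∃ Q : Γ.State ℕ, ∃ μ : ℕ ≃ ℕ ⊕ ℕ, Item.map μ '' Q = R := by
  refine ⟨Item.map Equiv.natSumNatEquivNat '' R, Equiv.natSumNatEquivNat.symm, ?_⟩
  rw [Set.image_image]
  simp only [Item.map_map, Equiv.symm_comp_self, Item.map_id, Set.image_id']

instance : Nonempty (Naming Γ) := by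
  classical
  let p : Γ.State (ℕ ⊕ ℕ) → Γ.State ℕ → Prop :=
    fun R Q => ∃ μ : ℕ ≃ ℕ ⊕ ℕ, Item.map μ '' Q = R
  have hp : ∀ R, p R (Classical.epsilon (p R)) := fun R => Classical.epsilon_spec (exists_rep R)
  refine ⟨⟨fun R => Classical.epsilon (p R), fun R => (hp R).choose,
    fun R => (hp R).choose_spec, ?_⟩⟩
  rintro R R' π rfl
  have : p R = p (Item.map π '' R) := by
    funext Q
    apply propext
    constructor
    · rintro ⟨μ, rfl⟩
      exact ⟨μ.trans π, by simp [Set.image_image, Item.map_map]⟩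
    · rintro ⟨μ, h⟩
      refine ⟨μ.trans π.symm, ?_⟩
      have := congrArg (fun S => Item.map π.symm '' S) h
      rw [Set.image_image, Set.image_image] at this
      simp only [Item.map_map, Equiv.symm_comp_self, Item.map_id, Set.image_id'] at this
      exact this
  simp only [this]

variable (Γ) in
/-- The start state `Q₀`; it has no parameters. -/
def startState : Γ.State ℕ := Closure {⟨none, 0, fun _ => none⟩}

namespace Naming

variable (N : Naming Γ)

/-- The state reached from `Q` by the transition labelled `ℓ`. -/
def target (Q : Γ.State ℕ) (ℓ : PLit Γ.arity (Option ℕ)) : Γ.State ℕ := N.rep (goto Q ℓ)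

/-- The states of the deterministic characteristic finite automaton (dCFA). -/
inductive IsState : Γ.State ℕ → Prop
  | start : IsState Γ.startState
  | step (Q : Γ.State ℕ) (ℓ : PLit Γ.arity (Option ℕ)) (hQ : IsState Q) (h : HasTransition Q ℓ) :
      IsState (N.target Q ℓ)

/-- The accepting state: the target of the transition from the start state for `Z()`. -/
def acceptState : Γ.State ℕ := N.target Γ.startState (Γ.start.map fun _ => none)

end Naming

/-- A reduce item has its dot at the end. -/
def Item.IsReduce {P : Type} (it : Γ.Item P) : Prop := it.dot = it.rhs.length

/-- In every dCFA state, each reduce item assigns a parameter to each node of the left-hand side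
of its rule, so that it determines the literal to which the parser reduces. -/
def Naming.LhsBound (N : Naming Γ) : Prop :=
  ∀ Q, N.IsState Q → ∀ it ∈ Q, it.IsReduce → ∀ r, it.rule = some r →
    ∀ x ∈ r.lhs.nodes, (it.bind x).isSome

/-! ### Assisted shift-reduce (ASR) parsing -/

/-- An input binding maps the parameters of a state to nodes of the input graph. -/
abbrev Binding (X : Type) := ℕ → Option X

variable (Γ) in
/-- A stack entry: a literal and, on top of it, a state with its input binding. -/
structure Frame where
  lit : Γ.Literal
  state : Γ.State ℕ
  bind : Binding X

variable (Γ) in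
/-- A parse stack, topmost entry first. The entry `Q₀^ι` at the bottom is left implicit:
`[]` is the stack that consists of `Q₀^ι` only. -/
abbrev Stack := List Γ.Frame

/-- The state `Q` and the input binding `τ` on top of the stack. -/
def Stack.top : Γ.Stack → Γ.State ℕ × Binding X
  | [] => (Γ.startState, fun _ => none)
  | F :: _ => (F.state, F.bind)

/-- The sequence of literals on the stack, from bottom to top. -/
def Stack.graph (S : Γ.Stack) : Γ.Gr := (S.map Frame.lit).reverse

/-- `e` can be read by a transition labelled `ℓ` under the input binding `τ`: the nodes of `e` at
parameters are the ones given by `τ`, and the nodes at placeholders are not in `U`. -/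
def Matches (τ : Binding X) (U : Set X) (e : Γ.Literal) (ℓ : PLit Γ.arity (Option ℕ)) : Prop :=
  ∃ φ : X → Option ℕ, e.map φ = ℓ ∧
    ∀ x ∈ e.nodes, (∀ p, φ x = some p → τ p = some x) ∧ (φ x = none → x ∉ U)

open Classical in
/-- The input binding after reading `e` by the transition from `Q` labelled `ℓ`. -/
noncomputable def Naming.nextBinding (N : Naming Γ) (Q : Γ.State ℕ) (τ : Binding X)
    (ℓ : PLit Γ.arity (Option ℕ)) (e : Γ.Literal) : Binding X :=
  fun q =>
    if q ∈ params (N.target Q ℓ) then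
      match N.ren (goto Q ℓ) q with
      | Sum.inl p => τ p
      | Sum.inr i => (List.ofFn e.att)[i]?
    else none

/-- Push `e` and the state reached from the topmost state by the transition labelled `ℓ`. -/
noncomputable def Naming.push (N : Naming Γ) (S : Γ.Stack) (ℓ : PLit Γ.arity (Option ℕ))
    (e : Γ.Literal) : Γ.Stack :=
  ⟨e, N.target (Stack.top S).1 ℓ, N.nextBinding (Stack.top S).1 (Stack.top S).2 ℓ e⟩ :: S

variable (Γ) in
/-- The triggers: transitions (given by their labels) and reduce items. -/
inductive Trigger
  | shift (ℓ : PLit Γ.arity (Option ℕ))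
  | reduce (it : Γ.Item ℕ)

/-- `t` is a trigger of the state `Q`. -/
def IsTrigger (Q : Γ.State ℕ) : Γ.Trigger → Prop
  | .shift ℓ => ℓ.sym ∈ Γ.terminal ∧ HasTransition Q ℓ
  | .reduce it => it ∈ Q ∧ it.IsReduce

variable (Γ) in
/-- An ASR configuration: the stack and the graph processed so far. -/
abbrev AsrConf := Γ.Stack × Γ.Gr

namespace Naming

variable (N : Naming Γ)

/-- The ASR move caused by a trigger of the topmost state. The item for `Start → Z` causes
acceptance and no move. -/
inductive AsrStep : Γ.Trigger → Γ.AsrConf → Γ.AsrConf → Prop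
  | shift (S : Γ.Stack) (g : Γ.Gr) (ℓ : PLit Γ.arity (Option ℕ)) (e : Γ.Literal)
      (ht : IsTrigger (Stack.top S).1 (.shift ℓ))
      (hm : Matches (Stack.top S).2 (Graph.nodes g ∪ Graph.nodes (Stack.graph S)) e ℓ) :
      AsrStep (.shift ℓ) (S, g) (N.push S ℓ e, g ++ [e])
  | reduce (F S : Γ.Stack) (g : Γ.Gr) (it : Γ.Item ℕ) (r : Rule Γ.arity X)
      (ht : IsTrigger (Stack.top (F ++ S)).1 (.reduce it)) (hr : it.rule = some r)
      (A : Γ.Literal) (ℓ : PLit Γ.arity (Option ℕ))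
      (hF : (Stack.graph F).map (fun e => e.map some) =
        r.rhs.map (fun e => e.map fun x => (it.bind x).bind (Stack.top (F ++ S)).2))
      (hA : A.map some = r.lhs.map fun x => (it.bind x).bind (Stack.top (F ++ S)).2)
      (hℓ : HasTransition (Stack.top S).1 ℓ)
      (hm : Matches (Stack.top S).2 (Graph.nodes (Stack.graph S)) A ℓ) :
      AsrStep (.reduce it) (F ++ S, g) (N.push S ℓ A, g)

def AsrMove (c c' : Γ.AsrConf) : Prop := ∃ t, N.AsrStep t c c'

/-- The ASR parser can reach `c'` from `c`. -/
def AsrReach : Γ.AsrConf → Γ.AsrConf → Prop := Relation.ReflTransGen N.AsrMove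

/-- An ASR configuration that is reached from the initial one. -/
def AsrReached (S : Γ.Stack) (g : Γ.Gr) : Prop := N.AsrReach ([], []) (S, g)

/-- A stack with the accepting state on top. -/
def Accepting (S : Γ.Stack) : Prop := (Stack.top S).1 = N.acceptState

/-! ### Follow sets and conflicts -/

/-- The graphs that are processed by successful sequences from `(S, g')` caused by `t`. The
item for `Start → Z` causes just the empty successful sequence. -/
def Success (S : Γ.Stack) (g' : Γ.Gr) (t : Γ.Trigger) : Set Γ.Gr :=
  {h | (h = [] ∧ N.Accepting S ∧ IsTrigger (Stack.top S).1 t ∧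
          ∃ it, t = .reduce it ∧ it.rule = none) ∨
       ∃ c S', N.AsrStep t (S, g') c ∧ N.AsrReach c (S', g' ++ h) ∧ N.Accepting S'}

end Naming

/-- Parameters, `–` (nodes not seen so far), and `•` (all other nodes). -/
inductive PNode
  | param (p : ℕ)
  | fresh
  | other

open Classical in
/-- The function that maps nodes to their categories, for a state `Q` with input binding `τ` and the
graph `g'` processed so far. -/
noncomputable def nodeClass (Q : Γ.State ℕ) (τ : Binding X) (g' : Γ.Gr) (x : X) : PNode :=
  if h : ∃ p ∈ params Q, τ p = some x then .param h.choose
  else if x ∉ Graph.nodes g' then .fresh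
  else .other

/-- The literals of a graph, as options; `none` is the end marker `$`. -/
def anyOf (h : Γ.Gr) : Set (Option Γ.Literal) := {o | (h = [] ∧ o = none) ∨ ∃ e ∈ h, o = some e}

namespace Naming

variable (N : Naming Γ)

/-- `Follow(Q, t)`: the categorized first literals of graphs in success sets; `none` is `$`. -/
def Follow (Q : Γ.State ℕ) (t : Γ.Trigger) : Set (Option (PLit Γ.arity PNode)) :=
  {o | ∃ S g' τ, N.AsrReached S g' ∧ Stack.top S = (Q, τ) ∧ ∃ h ∈ N.Success S g' t,
      o = h.head?.map fun e => e.map (nodeClass Q τ g')}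

/-- `Follow*(Q, t)`: the same for all literals of graphs in success sets. -/
def FollowAny (Q : Γ.State ℕ) (t : Γ.Trigger) : Set (Option (PLit Γ.arity PNode)) :=
  {o | ∃ S g' τ, N.AsrReached S g' ∧ Stack.top S = (Q, τ) ∧ ∃ h ∈ N.Success S g' t,
      ∃ a ∈ anyOf h, o = a.map fun e => e.map (nodeClass Q τ g')}

/-- `t ≺ t'` for triggers of `Q`. -/
def Precedes (Q : Γ.State ℕ) (t t' : Γ.Trigger) : Prop :=
  IsTrigger Q t ∧ IsTrigger Q t' ∧ t ≠ t' ∧ (N.FollowAny Q t ∩ N.Follow Q t').Nonempty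

/-- A set of triggers is in conflict if it is `{t₀, …, tₖ}` with `t₀ ≺ t₁ ≺ ⋯ ≺ tₖ ≺ t₀`
(the addition on `Fin (k + 1)` is cyclic). -/
def InConflict (Q : Γ.State ℕ) (T : Set Γ.Trigger) : Prop :=
  ∃ (k : ℕ) (t : Fin (k + 1) → Γ.Trigger), (∀ i, N.Precedes Q (t i) (t (i + 1))) ∧ T = Set.range t

def ConflictFree (Q : Γ.State ℕ) : Prop :=
  ∀ T : Set Γ.Trigger, T ⊆ {t | IsTrigger Q t} → ¬ N.InConflict Q T

/-! ### Selection of triggers -/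

/-- `ts` lists the triggers of `Q` in such a way that `Follow(Q, tᵢ) ∩ Follow*(Q, tⱼ) = ∅` for
all `i < j`. -/
def IsTriggerSequence (Q : Γ.State ℕ) (ts : List Γ.Trigger) : Prop :=
  ts.Nodup ∧ (∀ t, t ∈ ts ↔ IsTrigger Q t) ∧
    ts.Pairwise fun t t' => N.Follow Q t ∩ N.FollowAny Q t' = ∅

/-- `order` fixes such a sequence for each dCFA state that has one. -/
def IsTriggerOrder (order : Γ.State ℕ → List Γ.Trigger) : Prop :=
  ∀ Q, N.IsState Q → (∃ ts, N.IsTriggerSequence Q ts) → N.IsTriggerSequence Q (order Q)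

end Naming

/-- The literal `e` fits the pseudo-literal `ℓ` in `Q^τ`. -/
def Fits (Q : Γ.State ℕ) (τ : Binding X) (e : Γ.Literal) (ℓ : PLit Γ.arity PNode) : Prop :=
  ∃ φ : X → PNode, e.map φ = ℓ ∧
    ∀ x ∈ e.nodes, ∀ p ∈ params Q, φ x = .param p → τ p = some x

namespace Naming

variable (N : Naming Γ)

/-- The check of a single trigger `t` for the rest graph `g''` succeeds with the result `o`:
a literal of `g''` if `g''` is nonempty, and `$` (that is, `none`) otherwise. -/
def Hit (Q : Γ.State ℕ) (τ : Binding X) (g'' : Γ.Gr) (t : Γ.Trigger) :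
    Option Γ.Literal → Prop
  | some e => e ∈ g'' ∧ ∃ ℓ, some ℓ ∈ N.Follow Q t ∧ Fits Q τ e ℓ
  | none => g'' = [] ∧ none ∈ N.Follow Q t

/-- The procedure that selects a trigger may return `(t, o)`: `t` is the first trigger in the fixed
sequence whose check succeeds, and `o` is a result of this check. -/
def Selects (order : Γ.State ℕ → List Γ.Trigger) (Q : Γ.State ℕ) (τ : Binding X) (g'' : Γ.Gr)
    (t : Γ.Trigger) (o : Option Γ.Literal) : Prop :=
  ∃ pre post, order Q = pre ++ t :: post ∧ (∀ t' ∈ pre, ∀ o', ¬ N.Hit Q τ g'' t' o') ∧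
    N.Hit Q τ g'' t o

/-- From `(S, g')`, the trigger `t` causes a move that reads `e` and is the first move of a
successful sequence that processes `e h`. -/
def ShiftSucceeds (S : Γ.Stack) (g' : Γ.Gr) (t : Γ.Trigger) (e : Γ.Literal) (h : Γ.Gr) : Prop :=
  ∃ S' SA, N.AsrStep t (S, g') (S', g' ++ [e]) ∧
    N.AsrReach (S', g' ++ [e]) (SA, g' ++ e :: h) ∧ N.Accepting SA

/-- The return value `(t, e)` is useful in the configuration `(S, g')` with rest graph `g''`. -/
def Useful (S : Γ.Stack) (g' g'' : Γ.Gr) (t : Γ.Trigger) (e : Γ.Literal) : Prop :=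
  some (e.map (nodeClass (Stack.top S).1 (Stack.top S).2 g')) ∈ N.Follow (Stack.top S).1 t ∧
  ((∃ e' h', (e' :: h').Perm g'' ∧ N.ShiftSucceeds S g' t e' h') →
    ∃ h, (e :: h).Perm g'' ∧ N.ShiftSucceeds S g' t e h)

/-- From `(S, g')`, the rest graph `g''` can be processed entirely, in some order, by a
successful sequence. -/
def Completable (S : Γ.Stack) (g' g'' : Γ.Gr) : Prop :=
  ∃ h SA, h.Perm g'' ∧ N.AsrReach (S, g') (SA, g' ++ h) ∧ N.Accepting SA

/-- The free edge choice property: all return values are useful. This is demanded only for rest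
graphs that can be processed successfully, which is weaker than to demand it for all of them. -/
def FreeEdgeChoice (order : Γ.State ℕ → List Γ.Trigger) : Prop :=
  ∀ S g' g'', N.AsrReached S g' → Γ.IsTerminal g'' → g'' ≠ [] → N.Completable S g' g'' →
    ∀ t e, N.Selects order (Stack.top S).1 (Stack.top S).2 g'' t (some e) → N.Useful S g' g'' t e

end Naming

/-! ### Predictive shift-reduce (PSR) parsing -/

variable (Γ) in
/-- A PSR configuration: the stack, the graph processed so far, and the rest graph. -/
@[ext] structure PsrConf where
  stack : Γ.Stack
  read : Γ.Gr
  rest : Γ.Gr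

namespace Naming

variable (N : Naming Γ)

/-- The literal that a trigger appends to the processed graph, given the selected literal `o`. -/
def appended : Γ.Trigger → Option Γ.Literal → Γ.Gr
  | .shift _, o => o.toList
  | .reduce _, _ => []

/-- A PSR move. -/
def PsrMove (order : Γ.State ℕ → List Γ.Trigger) (c c' : Γ.PsrConf) : Prop :=
  ∃ t o, N.Selects order (Stack.top c.stack).1 (Stack.top c.stack).2 c.rest t o ∧
    c'.read = c.read ++ appended t o ∧
    (c.read ++ c.rest).Perm (c'.read ++ c'.rest) ∧
    N.AsrStep t (c.stack, c.read) (c'.stack, c'.read)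

/-- The PSR parser can reach `c'` from `c`. -/
def PsrReach (order : Γ.State ℕ → List Γ.Trigger) : Γ.PsrConf → Γ.PsrConf → Prop :=
  Relation.ReflTransGen (N.PsrMove order)

def PsrAccepting (c : Γ.PsrConf) : Prop := c.rest = [] ∧ N.Accepting c.stack

/-- The PSR parser can reach an accepting configuration from `c`. -/
def CanAccept (order : Γ.State ℕ → List Γ.Trigger) (c : Γ.PsrConf) : Prop :=
  ∃ c', N.PsrReach order c c' ∧ N.PsrAccepting c'

/-- The PSR parser accepts the graph `g`. -/
def PsrAccepts (order : Γ.State ℕ → List Γ.Trigger) (g : Γ.Gr) : Prop :=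
  N.CanAccept order ⟨[], [], g⟩

end Naming

end HRGrammar

end HR

/-! The proof compares both the grammar and the PSR parser with the nondeterministic ASR parser.

Soundness (`AsrReach.sound`): read backwards from an accepting configuration, an ASR run is a
derivation. The stack followed by the literals still to be read is always derivable from `Z()`; a
shift does not change this graph and a reduction undoes one derivation step. The nodes introduced by
that step are fresh because an item receives values only from nodes that are new to the stack, and
because a node read earlier can be read again only while it is on the stack. Every PSR move is an
ASR move that preserves the input up to permutation, so acceptance implies validity.

Completeness (`Generates.parse`): a terminal derivation is reorganised into the tree-like relation
`Generates`, and induction over it yields an ASR run that reads the derived graph in the order in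
which the derivation produces it.

Determinism (`selects_of_success`): conflict-freeness makes `≺` acyclic on the finitely many
triggers, so each dCFA state has a trigger sequence. Let the rest graph be processed by a successful
run starting with `t₀`. The check of `t₀` succeeds, so the selected `t` is not after `t₀`. It is not
before `t₀` either: by free edge choice the class of the returned literal lies in `Follow(t)`, and
it lies in `Follow*(t₀)` since the run reads this literal at some point. Hence `t = t₀`, and the
second clause of free edge choice exchanges the literal read by the run for the returned one.

Thus "some ASR run processes the rest graph in some order" is invariant under PSR moves
(`PsrMove.completable`) and by itself lets the PSR parser finish (`Completable.canAccept`). No PSR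
move on a valid graph is ever a wrong turn. -/

namespace HR

/-! ### Literals and graphs under node maps -/

section Literals

variable {Sym : Type} {arity : Sym → ℕ} {X V W : Type}

/-- The attachment type depends on the symbol; this replaces the resulting heterogeneous equality by
a pointwise one along `Fin.cast`, once and for all. -/
theorem Lit.map_eq_map_iff {Y : Type} {e : Lit arity X} {e' : Lit arity Y} {f : X → V}
    {f' : Y → V} : e.map f = e'.map f' ↔ ∃ h : e.sym = e'.sym,
      ∀ i, f (e.att i) = f' (e'.att (Fin.cast (congrArg arity h) i)) := by
  obtain ⟨s, a⟩ := e
  obtain ⟨s', a'⟩ := e'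
  simp only [Lit.map, PLit.mk.injEq]
  constructor
  · rintro ⟨rfl, h⟩
    exact ⟨rfl, fun i => congrFun (eq_of_heq h) i⟩
  · rintro ⟨rfl, h⟩
    exact ⟨rfl, heq_of_eq (funext h)⟩

theorem Lit.map_congr {e : Lit arity X} {f f' : X → V} (h : ∀ x ∈ e.nodes, f x = f' x) :
    e.map f = e.map f' :=
  Lit.map_eq_map_iff.2 ⟨rfl, fun i => h _ ⟨i, rfl⟩⟩

theorem Lit.eq_of_map_eq {e : Lit arity X} {f f' : X → V} (h : e.map f = e.map f') {x : X}
    (hx : x ∈ e.nodes) : f x = f' x := by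
  obtain ⟨i, rfl⟩ := hx
  obtain ⟨_, h⟩ := Lit.map_eq_map_iff.1 h
  exact h i

theorem Lit.exists_of_map_eq {Y : Type} {e : Lit arity X} {e' : Lit arity Y} {f : X → V}
    {f' : Y → V} (h : e.map f = e'.map f') {x : X} (hx : x ∈ e.nodes) :
    ∃ x' ∈ e'.nodes, f x = f' x' := by
  obtain ⟨i, rfl⟩ := hx
  obtain ⟨_, h⟩ := Lit.map_eq_map_iff.1 h
  exact ⟨_, ⟨_, rfl⟩, h i⟩

theorem Lit.map_comp_eq {Y : Type} {e : Lit arity X} {e' : Lit arity Y} {f : X → V}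
    {f' : Y → V} (h : e.map f = e'.map f') (k : V → W) :
    e.map (fun x => k (f x)) = e'.map (fun x => k (f' x)) := by
  obtain ⟨hs, h⟩ := Lit.map_eq_map_iff.1 h
  exact Lit.map_eq_map_iff.2 ⟨hs, fun i => congrArg k (h i)⟩

theorem Lit.map_some_injective {e e' : Lit arity X} (h : e.map some = e'.map some) : e = e' := by
  obtain ⟨s, a⟩ := e
  obtain ⟨s', a'⟩ := e'
  obtain ⟨hs, h⟩ := Lit.map_eq_map_iff.1 h
  cases hs
  congr 1
  ext i
  exact Option.some_injective _ (h i)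

theorem Lit.mem_nodes_rename {e : Lit arity X} {μ : X ↪ X} {y : X} :
    y ∈ (e.rename μ).nodes ↔ ∃ x ∈ e.nodes, μ x = y := by
  constructor
  · rintro ⟨i, rfl⟩
    exact ⟨e.att i, ⟨i, rfl⟩, rfl⟩
  · rintro ⟨_, ⟨i, rfl⟩, rfl⟩
    exact ⟨i, rfl⟩

theorem Lit.map_some_eq_iff {e e' : Lit arity X} {v : X → Option X} {μ : X ↪ X}
    (h : ∀ x ∈ e'.nodes, v x = some (μ x)) : e.map some = e'.map v ↔ e = e'.rename μ := by
  have : e'.map v = (e'.rename μ).map some := Lit.map_congr (f' := fun x => some (μ x)) h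
  rw [this]
  exact ⟨Lit.map_some_injective, fun h => h ▸ rfl⟩

theorem Lit.nodes_finite (e : Lit arity X) : e.nodes.Finite := Set.finite_range _

@[simp] theorem Graph.mem_nodes_cons {e : Lit arity X} {g : Graph arity X} {y : X} :
    y ∈ Graph.nodes (e :: g) ↔ y ∈ e.nodes ∨ y ∈ Graph.nodes g := by
  simp [Graph.nodes]

@[simp] theorem Graph.mem_nodes_append {g h : Graph arity X} {y : X} :
    y ∈ Graph.nodes (g ++ h) ↔ y ∈ Graph.nodes g ∨ y ∈ Graph.nodes h := by
  simp [Graph.nodes, or_and_right, exists_or]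

@[simp] theorem Graph.mem_nodes_nil {y : X} : y ∉ Graph.nodes ([] : Graph arity X) := by
  simp [Graph.nodes]

theorem Graph.mem_nodes_rename {g : Graph arity X} {μ : X ↪ X} {y : X} :
    y ∈ Graph.nodes (g.map fun e => e.rename μ) ↔ ∃ x ∈ Graph.nodes g, μ x = y := by
  simp only [Graph.nodes, List.mem_map, Set.mem_ofPred_eq]
  constructor
  · rintro ⟨_, ⟨e, he, rfl⟩, hy⟩
    obtain ⟨x, hx, rfl⟩ := Lit.mem_nodes_rename.1 hy
    exact ⟨x, ⟨e, he, hx⟩, rfl⟩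
  · rintro ⟨x, ⟨e, he, hx⟩, rfl⟩
    exact ⟨_, ⟨e, he, rfl⟩, Lit.mem_nodes_rename.2 ⟨x, hx, rfl⟩⟩

end Literals

namespace HRGrammar

variable {X : Type} {Γ : HRGrammar X}

/-! ### Regularity and finiteness of states -/

/-- The properties shared by all items of dCFA states. -/
structure Item.Regular {P : Type} (it : Γ.Item P) : Prop where
  rule_mem : ∀ r, it.rule = some r → r ∈ Γ.rules
  inj : ∀ x y p, it.bind x = some p → it.bind y = some p → x = y
  support : {x | it.bind x ≠ none}.Finite
  initial : it.dot = 0 → ∀ r, it.rule = some r → ∀ x ∉ r.lhs.nodes, it.bind x = none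

theorem Closure.regular {P : Type} {K : Γ.State P} (hK : ∀ it ∈ K, it.Regular) {it : Γ.Item P}
    (h : it ∈ Closure K) : it.Regular := by
  induction h with
  | base it h => exact hK it h
  | call it h B hB r hr β hpass hrest ih =>
    have hmem : ∀ x, β x ≠ none → x ∈ r.lhs.nodes := fun x hx => by
      by_contra h'
      exact hx (hrest x h')
    refine ⟨?_, ?_, r.lhs.nodes_finite.subset hmem, ?_⟩
    · rintro _ ⟨⟩
      exact hr
    · intro x y p hx hy
      obtain ⟨i, rfl⟩ := hmem x (by simp_all)
      obtain ⟨j, rfl⟩ := hmem y (by simp_all)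
      obtain ⟨hs, h'⟩ := Lit.map_eq_map_iff.1 hpass
      have := B.att.injective (ih.inj _ _ p ((h' i).symm.trans hx) ((h' j).symm.trans hy))
      rw [Fin.cast_injective _ this]
    · rintro - _ ⟨⟩
      exact hrest

theorem Moves.regular {P : Type} {ℓ : PLit Γ.arity (Option P)} {it : Γ.Item P}
    {it' : Γ.Item (P ⊕ ℕ)} (h : Moves ℓ it it') (hit : it.Regular) : it'.Regular := by
  obtain ⟨e, hnext, hℓ, hrule, hdot, hold, hnew, hnone⟩ := h
  -- Each parameter of the moved item is either old (`inl`) or a position of `e` (`inr`); as the two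
  -- kinds are disjoint, injectivity can be checked on each separately.
  have key : ∀ x q, it'.bind x = some q → (∃ p, it.bind x = some p ∧ q = .inl p) ∨
      ∃ i, e.att i = x ∧ q = .inr (i : ℕ) := by
    intro x q hq
    cases hb : it.bind x with
    | some p =>
      rw [hold x p hb] at hq
      exact .inl ⟨p, rfl, (Option.some_injective _ hq).symm⟩
    | none =>
      by_cases hx : x ∈ e.nodes
      · obtain ⟨i, rfl⟩ := hx
        rw [hnew i hb] at hq
        exact .inr ⟨i, rfl, (Option.some_injective _ hq).symm⟩
      · rw [hnone x hx hb] at hq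
        cases hq
  refine ⟨fun r hr => hit.rule_mem r (hrule ▸ hr), ?_, ?_, ?_⟩
  · intro x y q hx hy
    rcases key x q hx with ⟨p, hp, rfl⟩ | ⟨i, rfl, rfl⟩ <;>
    rcases key y _ hy with ⟨p', hp', h⟩ | ⟨j, rfl, h⟩
    · cases h
      exact hit.inj _ _ _ hp hp'
    · cases h
    · cases h
    · rw [Fin.ext (Sum.inr_injective h)]
  · refine (hit.support.union e.nodes_finite).subset fun x hx => ?_
    obtain ⟨q, hq⟩ := Option.ne_none_iff_exists'.1 hx
    rcases key x q hq with ⟨p, hp, -⟩ | ⟨i, rfl, -⟩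
    · exact .inl (by simp [hp])
    · exact .inr ⟨i, rfl⟩
  · intro h0
    omega

/-- The item alone fixes the literal after its dot and the new parameters. Hence a finite state has
finitely many moved items. -/
theorem Moves.eq {P : Type} {ℓ ℓ' : PLit Γ.arity (Option P)} {it : Γ.Item P}
    {it' it'' : Γ.Item (P ⊕ ℕ)} (h : Moves ℓ it it') (h' : Moves ℓ' it it'') : it' = it'' := by
  obtain ⟨e, hnext, -, hrule, hdot, hold, hnew, hnone⟩ := h
  obtain ⟨e', hnext', -, hrule', hdot', hold', hnew', hnone'⟩ := h'
  obtain rfl : e = e' := by simpa [hnext] using hnext'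
  refine Item.ext (hrule.trans hrule'.symm) (hdot.trans hdot'.symm) (funext fun x => ?_)
  cases hb : it.bind x with
  | some p => rw [hold x p hb, hold' x p hb]
  | none =>
    by_cases hx : x ∈ e.nodes
    · obtain ⟨i, rfl⟩ := hx
      rw [hnew i hb, hnew' i hb]
    · rw [hnone x hx hb, hnone' x hx hb]

theorem Moves.exists {P : Type} {it : Γ.Item P} {e : Γ.Literal} (he : it.next = some e) :
    ∃ it', Moves (e.map it.bind) it it' := by
  classical
  refine ⟨⟨it.rule, it.dot + 1, fun x => match it.bind x with
    | some p => some (.inl p)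
    | none => if h : ∃ i, e.att i = x then some (.inr (h.choose : ℕ)) else none⟩,
    e, he, rfl, rfl, rfl, ?_, ?_, ?_⟩
  · intro x p hp
    simp [hp]
  · intro i hi
    have h : ∃ j, e.att j = e.att i := ⟨i, rfl⟩
    simp only [hi, h, dite_true, e.att.injective h.choose_spec]
  · intro x hx hb
    have h : ¬ ∃ i, e.att i = x := hx
    simp only [hb, h, dite_false]

theorem Item.map_injective {P P' : Type} {f : P → P'} (hf : Function.Injective f) :
    Function.Injective (Item.map f : Γ.Item P → Γ.Item P') := by
  intro it it' h
  simp only [Item.map, Item.mk.injEq] at h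
  exact Item.ext h.1 h.2.1 (funext fun x => Option.map_injective hf (congrFun h.2.2 x))

theorem Item.regular_map_iff {P P' : Type} {f : P → P'} (hf : Function.Injective f)
    {it : Γ.Item P} : (it.map f).Regular ↔ it.Regular := by
  constructor
  · intro h
    refine ⟨h.rule_mem, fun x y p hx hy => h.inj x y (f p) (by simp [Item.map, hx])
      (by simp [Item.map, hy]), by simpa [Item.map] using h.support, ?_⟩
    simpa [Item.map] using h.initial
  · intro h
    refine ⟨h.rule_mem, fun x y p hx hy => ?_, by simpa [Item.map] using h.support, ?_⟩
    · simp only [Item.map, Option.map_eq_some_iff] at hx hy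
      obtain ⟨a, ha, rfl⟩ := hx
      obtain ⟨b, hb, hab⟩ := hy
      obtain rfl := hf hab
      exact h.inj _ _ _ ha hb
    · simpa [Item.map] using h.initial

theorem params_finite {P : Type} {Q : Γ.State P} (hQ : Q.Finite) (hreg : ∀ it ∈ Q, it.Regular) :
    (params Q).Finite := by
  have : params Q ⊆ ⋃ it ∈ Q, {p | some p ∈ it.bind '' {x | it.bind x ≠ none}} := by
    rintro p ⟨it, hit, x, hx⟩
    simp only [Set.mem_iUnion]
    exact ⟨it, hit, x, by simp [hx], hx⟩
  refine (hQ.biUnion fun it hit => ?_).subset this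
  exact ((hreg it hit).support.image _).preimage (Option.some_injective _).injOn

/-- Closure only passes parameters on, so every parameter can be traced back to a kernel item. -/
theorem params_closure {P : Type} (K : Γ.State P) : params (Closure K) ⊆ params K := by
  rintro p ⟨it, hit, x, hx⟩
  induction hit generalizing x with
  | base it h => exact ⟨it, h, x, hx⟩
  | call it h B hB r hr β hpass hrest ih =>
    have hmem : x ∈ r.lhs.nodes := by
      by_contra h'
      simp [hrest x h'] at hx
    obtain ⟨x', -, h'⟩ := Lit.exists_of_map_eq hpass hmem
    exact ih x' (h'.symm.trans hx)

theorem finite_setOf_support {V : Type} {s : Set X} (hs : s.Finite) {T : Set V} (hT : T.Finite) :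
    {β : X → Option V | (∀ x ∉ s, β x = none) ∧ ∀ x p, β x = some p → p ∈ T}.Finite := by
  have := hs.to_subtype
  have hO : {o : Option V | ∀ p, o = some p → p ∈ T}.Finite := by
    refine ((hT.image some).insert none).subset ?_
    rintro (_ | p) h
    · simp
    · simpa using h p rfl
  refine Set.Finite.of_finite_image (f := fun β (x : s) => β x)
    ((Set.Finite.pi' fun _ : s => hO).subset ?_) ?_
  · rintro _ ⟨β, hβ, rfl⟩ x
    exact hβ.2 x
  · intro β hβ β' hβ' h
    funext x
    by_cases hx : x ∈ s
    · exact congrFun h ⟨x, hx⟩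
    · rw [hβ.1 x hx, hβ'.1 x hx]

/-- An item added by closure consists of one of finitely many rules, the dot at `0`, and an
assignment supported on the left-hand side with values in the finite set of kernel parameters. -/
theorem closure_finite {P : Type} {K : Γ.State P} (hK : K.Finite) (hreg : ∀ it ∈ K, it.Regular) :
    (Closure K).Finite := by
  have hfin : (⋃ r ∈ Γ.rules, (fun β => (⟨some r, 0, β⟩ : Γ.Item P)) ''
      {β | (∀ x ∉ r.lhs.nodes, β x = none) ∧ ∀ x p, β x = some p → p ∈ params K}).Finite :=
    Γ.finite_rules.biUnion fun r _ =>
      (finite_setOf_support r.lhs.nodes_finite (params_finite hK hreg)).image _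
  refine (hK.union hfin).subset fun it hit => ?_
  have hp : ∀ x p, it.bind x = some p → p ∈ params K :=
    fun x p h => params_closure K ⟨it, hit, x, h⟩
  cases hit with
  | base _ h => exact .inl h
  | call it h B hB r hr β hpass hrest =>
    refine .inr ?_
    simp only [Set.mem_iUnion]
    exact ⟨r, hr, β, ⟨hrest, hp⟩, rfl⟩

theorem finite_moves {P : Type} {Q : Γ.State P} (hQ : Q.Finite) (ℓ : PLit Γ.arity (Option P)) :
    {it' | ∃ it ∈ Q, Moves ℓ it it'}.Finite := by
  have : {it' | ∃ it ∈ Q, Moves ℓ it it'} = ⋃ it ∈ Q, {it' | Moves ℓ it it'} := by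
    ext
    simp
  rw [this]
  exact hQ.biUnion fun it _ => Set.Subsingleton.finite fun _ h _ h' => h.eq h'

theorem regular_startState {it : Γ.Item ℕ} (h : it ∈ Γ.startState) : it.Regular := by
  refine Closure.regular ?_ h
  rintro _ rfl
  exact ⟨by simp, by simp, by simp, by simp⟩

theorem goto_regular {P : Type} {Q : Γ.State P} (hQ : ∀ it ∈ Q, it.Regular)
    {ℓ : PLit Γ.arity (Option P)} {it : Γ.Item (P ⊕ ℕ)} (h : it ∈ goto Q ℓ) : it.Regular := by
  refine Closure.regular ?_ h
  rintro it' ⟨it, hit, hm⟩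
  exact hm.regular (hQ it hit)

namespace Naming

variable {N : Naming Γ}

theorem mem_target {Q : Γ.State ℕ} {ℓ : PLit Γ.arity (Option ℕ)} {it : Γ.Item ℕ} :
    it ∈ N.target Q ℓ ↔ it.map (N.ren (goto Q ℓ)) ∈ goto Q ℓ := by
  have h := N.image_rep (goto Q ℓ)
  constructor
  · intro hit
    exact h.subset ⟨it, hit, rfl⟩
  · intro hit
    obtain ⟨it', hit', h'⟩ := h.superset hit
    rwa [← Item.map_injective (N.ren (goto Q ℓ)).injective h']

theorem IsState.finite_regular {Q : Γ.State ℕ} (hQ : N.IsState Q) :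
    Q.Finite ∧ ∀ it ∈ Q, it.Regular := by
  induction hQ with
  | start =>
    refine ⟨closure_finite (Set.finite_singleton _) ?_, fun it => regular_startState⟩
    exact fun it hit => regular_startState (.base it hit)
  | step Q ℓ hQ h ih =>
    refine ⟨?_, fun it hit => ?_⟩
    · have : (goto Q ℓ).Finite := by
        refine closure_finite (finite_moves ih.1 ℓ) ?_
        rintro it' ⟨it, hit, hm⟩
        exact hm.regular (ih.2 it hit)
      refine Set.Finite.of_finite_image (f := Item.map (N.ren (goto Q ℓ))) ?_
        (Item.map_injective (N.ren (goto Q ℓ)).injective).injOn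
      rw [target, N.image_rep]
      exact this
    · rw [← Item.regular_map_iff (N.ren (goto Q ℓ)).injective]
      exact goto_regular ih.2 (mem_target.1 hit)

/-- Needed for sorting the triggers of a state topologically. -/
theorem IsState.finite_triggers {Q : Γ.State ℕ} (hQ : N.IsState Q) :
    {t | IsTrigger Q t}.Finite := by
  have hfin := hQ.finite_regular.1
  have hl : {ℓ | HasTransition Q ℓ}.Finite := by
    refine ((hfin.image fun it => it.next.map fun e => e.map it.bind).preimage
      (Option.some_injective _).injOn).subset ?_
    rintro ℓ ⟨it, hit, it', e, he, hℓ, -⟩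
    exact ⟨it, hit, by simp [he, hℓ]⟩
  refine ((hl.image Trigger.shift).union (hfin.image Trigger.reduce)).subset ?_
  rintro (ℓ | it) h
  · exact .inl ⟨ℓ, h.2, rfl⟩
  · exact .inr ⟨it, h.1, rfl⟩

end Naming

/-! ### Stacks built by the parser -/

/-- The partial map from the nodes of the rule to input nodes given by an item and a binding of its
parameters. -/
def Item.val {P : Type} (it : Γ.Item P) (τ : P → Option X) : X → Option X :=
  fun x => (it.bind x).bind τ

/-- The values of old and new parameters after reading `e`. -/
def readBinding (τ : Binding X) (e : Γ.Literal) : ℕ ⊕ ℕ → Option X :=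
  Sum.elim τ fun i => (List.ofFn e.att)[i]?

theorem readBinding_inr (τ : Binding X) (e : Γ.Literal) (i : Fin (Γ.arity e.sym)) :
    readBinding τ e (.inr (i : ℕ)) = some (e.att i) := by
  simp [readBinding]

theorem Matches.mono {τ : Binding X} {U U' : Set X} {e : Γ.Literal}
    {ℓ : PLit Γ.arity (Option ℕ)} (h : Matches τ U e ℓ) (hU : U' ⊆ U) : Matches τ U' e ℓ := by
  obtain ⟨φ, h1, h2⟩ := h
  exact ⟨φ, h1, fun x hx => ⟨(h2 x hx).1, fun h0 h' => (h2 x hx).2 h0 (hU h')⟩⟩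

/-- Reading a literal only extends the valuation of an item, and each added value is a node of that
literal outside `U`. All later freshness arguments rest on this. -/
theorem Moves.val {it : Γ.Item ℕ} {it' : Γ.Item (ℕ ⊕ ℕ)} {ℓ : PLit Γ.arity (Option ℕ)}
    (h : Moves ℓ it it') {τ : Binding X} {U : Set X} {e e₀ : Γ.Literal}
    (he₀ : it.next = some e₀) (hm : Matches τ U e ℓ) :
    e.map some = e₀.map (it'.val (readBinding τ e)) ∧
    (∀ x y, it.val τ x = some y → it'.val (readBinding τ e) x = some y) ∧
    ∀ x y, it'.val (readBinding τ e) x = some y →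
      it.val τ x = some y ∨ (x ∈ e₀.nodes ∧ it.bind x = none ∧ y ∈ e.nodes ∧ y ∉ U) := by
  obtain ⟨e₁, he₁, hℓ, -, -, hold, hnew, hnone⟩ := h
  obtain rfl : e₁ = e₀ := by simpa [he₁] using he₀
  obtain ⟨φ, hφ, hm⟩ := hm
  obtain ⟨hs, hφ⟩ := Lit.map_eq_map_iff.1 (hφ.trans hℓ.symm)
  have hval : ∀ i, it.bind (e₁.att (Fin.cast (congrArg Γ.arity hs) i)) = none →
      it'.val (readBinding τ e) (e₁.att (Fin.cast (congrArg Γ.arity hs) i)) =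
        some (e.att i) := by
    intro i hi
    rw [Item.val, hnew _ hi]
    exact readBinding_inr τ e i
  have hold' : ∀ x p, it.bind x = some p → it'.val (readBinding τ e) x = τ p := by
    intro x p hp
    rw [Item.val, hold x p hp]
    rfl
  refine ⟨Lit.map_eq_map_iff.2 ⟨hs, fun i => ?_⟩, fun x y hy => ?_, fun x y hy => ?_⟩
  · cases hb : it.bind (e₁.att (Fin.cast (congrArg Γ.arity hs) i)) with
    | none => exact (hval i hb).symm
    | some p =>
      rw [hold' _ p hb]
      exact ((hm _ ⟨i, rfl⟩).1 p ((hφ i).trans hb)).symm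
  · obtain ⟨p, hp, hτ⟩ := Option.bind_eq_some_iff.1 hy
    rw [hold' x p hp, hτ]
  · cases hb : it.bind x with
    | some p =>
      rw [hold' x p hb] at hy
      simp [Item.val, hb, hy]
    | none =>
      by_cases hx : x ∈ e₁.nodes
      · obtain ⟨j, rfl⟩ := hx
        obtain ⟨i, rfl⟩ : ∃ i, Fin.cast (congrArg Γ.arity hs) i = j :=
          ⟨Fin.cast (congrArg Γ.arity hs.symm) j, rfl⟩
        rw [hval i hb] at hy
        cases hy
        exact .inr ⟨⟨_, rfl⟩, rfl, ⟨i, rfl⟩, (hm _ ⟨i, rfl⟩).2 ((hφ i).trans hb)⟩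
      · simp [Item.val, hnone x hx hb] at hy

@[simp] theorem Stack.graph_nil : Stack.graph ([] : Γ.Stack) = [] := rfl

@[simp] theorem Stack.graph_append (S S' : Γ.Stack) :
    Stack.graph (S ++ S') = Stack.graph S' ++ Stack.graph S := by
  simp [Stack.graph]

namespace Naming

variable {N : Naming Γ}

/-- The arbitrary renaming of parameters cancels in valuations. From here on arguments about items
can use node values instead of parameter names. -/
theorem val_nextBinding {Q : Γ.State ℕ} {ℓ : PLit Γ.arity (Option ℕ)} {it : Γ.Item ℕ}
    (h : it ∈ N.target Q ℓ) (τ : Binding X) (e : Γ.Literal) :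
    it.val (N.nextBinding Q τ ℓ e) = (it.map (N.ren (goto Q ℓ))).val (readBinding τ e) := by
  funext x
  cases hb : it.bind x with
  | none => simp [Item.val, Item.map, hb]
  | some q =>
    have hq : q ∈ params (N.target Q ℓ) := ⟨it, h, x, hb⟩
    simp only [Item.val, Item.map, hb, Option.bind_some, Option.map_some, nextBinding, hq, if_true,
      readBinding]
    cases N.ren (goto Q ℓ) q <;> rfl

@[simp] theorem graph_push (S : Γ.Stack) (ℓ : PLit Γ.arity (Option ℕ)) (e : Γ.Literal) :
    Stack.graph (N.push S ℓ e) = Stack.graph S ++ [e] := by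
  simp [push, Stack.graph]

@[simp] theorem top_push (S : Γ.Stack) (ℓ : PLit Γ.arity (Option ℕ)) (e : Γ.Literal) :
    Stack.top (N.push S ℓ e) = (N.target (Stack.top S).1 ℓ,
      N.nextBinding (Stack.top S).1 (Stack.top S).2 ℓ e) := rfl

variable (N) in
/-- Stacks that arise by pushing literals along transitions, with new nodes at placeholders. -/
inductive Proper : Γ.Stack → Prop
  | nil : Proper []
  | push (S : Γ.Stack) (ℓ : PLit Γ.arity (Option ℕ)) (e : Γ.Literal) (hS : Proper S)
      (hℓ : HasTransition (Stack.top S).1 ℓ)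
      (hm : Matches (Stack.top S).2 (Graph.nodes (Stack.graph S)) e ℓ) : Proper (N.push S ℓ e)

theorem Proper.of_append {F S : Γ.Stack} (h : N.Proper (F ++ S)) : N.Proper S := by
  induction F with
  | nil => exact h
  | cons f F ih =>
    generalize hT : f :: F ++ S = T at h
    cases h with
    | nil => simp at hT
    | push S' ℓ e hS =>
      simp only [List.cons_append, Naming.push, List.cons.injEq] at hT
      exact ih (hT.2 ▸ hS)

theorem Proper.isState {S : Γ.Stack} (h : N.Proper S) : N.IsState (Stack.top S).1 := by
  induction h with
  | nil => exact .start
  | push S ℓ e hS hℓ hm ih => exact .step _ _ ih hℓ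

theorem Proper.regular {S : Γ.Stack} (h : N.Proper S) {it : Γ.Item ℕ}
    (hit : it ∈ (Stack.top S).1) : it.Regular :=
  h.isState.finite_regular.2 it hit

/-- A parameter of the target is inherited or comes from a placeholder position, whose node is then
outside `U`. -/
theorem params_target {Q : Γ.State ℕ} {ℓ : PLit Γ.arity (Option ℕ)} {τ : Binding X} {U : Set X}
    {e : Γ.Literal} (hm : Matches τ U e ℓ) {q : ℕ} (hq : q ∈ params (N.target Q ℓ)) :
    (∃ p ∈ params Q, N.ren (goto Q ℓ) q = .inl p ∧ N.nextBinding Q τ ℓ e q = τ p) ∨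
    ∃ i : Fin (Γ.arity e.sym), N.ren (goto Q ℓ) q = .inr (i : ℕ) ∧
      N.nextBinding Q τ ℓ e q = some (e.att i) ∧ e.att i ∉ U := by
  obtain ⟨it, hit, x, hx⟩ := id hq
  obtain ⟨it', ⟨it₀, hit₀, e₀, -, hℓ, -, -, hold, hnew, hnone⟩, x, hx⟩ :=
    params_closure _ ⟨_, mem_target.1 hit, x,
      show (it.bind x).map _ = some (N.ren (goto Q ℓ) q) by rw [hx]; rfl⟩
  cases hb : it₀.bind x with
  | some p =>
    rw [hold x p hb] at hx
    have hr := (Option.some_injective _ hx).symm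
    refine .inl ⟨p, ⟨it₀, hit₀, x, hb⟩, hr, ?_⟩
    simp only [nextBinding, hq, if_true, hr]
  | none =>
    by_cases hmem : x ∈ e₀.nodes
    · obtain ⟨j, rfl⟩ := hmem
      rw [hnew j hb] at hx
      have hr := (Option.some_injective _ hx).symm
      obtain ⟨φ, hφ, hm⟩ := hm
      obtain ⟨hs, hφ⟩ := Lit.map_eq_map_iff.1 (hφ.trans hℓ.symm)
      refine .inr ⟨Fin.cast (congrArg Γ.arity hs.symm) j, hr, ?_,
        (hm _ ⟨_, rfl⟩).2 ((hφ _).trans hb)⟩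
      simp only [nextBinding, hq, if_true, hr]
      exact readBinding_inr τ e (Fin.cast (congrArg Γ.arity hs.symm) j)
    · rw [hnone x hmem hb] at hx
      cases hx

theorem Proper.bound {S : Γ.Stack} (h : N.Proper S) :
    ∀ p ∈ params (Stack.top S).1, ∃ x ∈ Graph.nodes (Stack.graph S),
      (Stack.top S).2 p = some x := by
  induction h with
  | nil =>
    intro p hp
    obtain ⟨it, rfl, x, hx⟩ := params_closure _ hp
    cases hx
  | push S ℓ e hS hℓ hm ih =>
    intro q hq
    simp only [top_push, graph_push, Graph.mem_nodes_append, Graph.mem_nodes_cons,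
      Graph.mem_nodes_nil, or_false]
    rcases params_target hm hq with ⟨p, hp, -, h⟩ | ⟨i, -, h, -⟩
    · obtain ⟨x, hx, hτ⟩ := ih p hp
      exact ⟨x, .inl hx, h.trans hτ⟩
    · exact ⟨_, .inr ⟨i, rfl⟩, h⟩

/-- Inherited parameters are bound to nodes on the stack, new ones to distinct nodes off the stack,
so no two can coincide. -/
theorem Proper.inj {S : Γ.Stack} (h : N.Proper S) :
    ∀ p ∈ params (Stack.top S).1, ∀ q ∈ params (Stack.top S).1,
      (Stack.top S).2 p = (Stack.top S).2 q → p = q := by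
  induction h with
  | nil =>
    intro p hp
    obtain ⟨it, rfl, x, hx⟩ := params_closure _ hp
    cases hx
  | push S ℓ e hS hℓ hm ih =>
    intro q hq q' hq' heq
    simp only [top_push] at heq
    apply (N.ren (goto (Stack.top S).1 ℓ)).injective
    rcases params_target hm hq with ⟨p, hp, hr, h⟩ | ⟨i, hr, h, hU⟩ <;>
    rcases params_target hm hq' with ⟨p', hp', hr', h'⟩ | ⟨i', hr', h', hU'⟩ <;>
    rw [h, h'] at heq <;> rw [hr, hr']
    · rw [ih p hp p' hp' heq]
    · obtain ⟨x, hx, hτ⟩ := hS.bound p hp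
      rw [hτ] at heq
      cases heq
      exact absurd hx hU'
    · obtain ⟨x, hx, hτ⟩ := hS.bound p' hp'
      rw [hτ] at heq
      cases heq
      exact absurd hx hU
    · rw [e.att.injective (Option.some_injective _ heq)]

theorem Proper.mem_of_bind {S : Γ.Stack} (h : N.Proper S) {p : ℕ} {y : X}
    (hτ : (Stack.top S).2 p = some y) : y ∈ Graph.nodes (Stack.graph S) := by
  by_cases hp : p ∈ params (Stack.top S).1
  · obtain ⟨z, hz, hτ'⟩ := h.bound p hp
    cases hτ.symm.trans hτ'
    exact hz
  -- Outside the parameters of the state the binding is `none` by definition.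
  · cases h with
    | nil => cases hτ
    | push S ℓ e =>
      simp only [top_push] at hp
      simp [nextBinding, hp] at hτ

theorem Proper.val_eq_none_iff {S : Γ.Stack} (h : N.Proper S) {it : Γ.Item ℕ}
    (hit : it ∈ (Stack.top S).1) {x : X} :
    it.val (Stack.top S).2 x = none ↔ it.bind x = none := by
  cases hb : it.bind x with
  | none => simp [Item.val, hb]
  | some p =>
    obtain ⟨y, -, hy⟩ := h.bound p ⟨it, hit, x, hb⟩
    simp [Item.val, hb, hy]

theorem Proper.val_mem {S : Γ.Stack} (h : N.Proper S) {it : Γ.Item ℕ} {x y : X}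
    (hv : it.val (Stack.top S).2 x = some y) :
    y ∈ Graph.nodes (Stack.graph S) := by
  obtain ⟨p, -, hτ⟩ := Option.bind_eq_some_iff.1 hv
  exact h.mem_of_bind hτ

theorem Proper.val_inj {S : Γ.Stack} (h : N.Proper S) {it : Γ.Item ℕ}
    (hit : it ∈ (Stack.top S).1) {x x' y : X} (hv : it.val (Stack.top S).2 x = some y)
    (hv' : it.val (Stack.top S).2 x' = some y) : x = x' := by
  obtain ⟨p, hp, hτ⟩ := Option.bind_eq_some_iff.1 hv
  obtain ⟨p', hp', hτ'⟩ := Option.bind_eq_some_iff.1 hv'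
  obtain rfl := h.inj p ⟨it, hit, x, hp⟩ p' ⟨it, hit, x', hp'⟩ (hτ.trans hτ'.symm)
  exact (h.regular hit).inj _ _ _ hp hp'

theorem exists_moved {S : Γ.Stack} {ℓ : PLit Γ.arity (Option ℕ)} {it : Γ.Item ℕ}
    (hit : it ∈ (Stack.top S).1) {it' : Γ.Item (ℕ ⊕ ℕ)} (hmv : Moves ℓ it it') (e : Γ.Literal) :
    ∃ it'' ∈ (Stack.top (N.push S ℓ e)).1, it''.rule = it.rule ∧ it''.dot = it.dot + 1 ∧
      it''.val (Stack.top (N.push S ℓ e)).2 = it'.val (readBinding (Stack.top S).2 e) := by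
  obtain ⟨it'', hit'', rfl⟩ := (N.image_rep (goto (Stack.top S).1 ℓ)).superset
    (Closure.base it' ⟨it, hit, hmv⟩)
  obtain ⟨e₀, -, -, hrule, hdot, -⟩ := hmv
  exact ⟨it'', hit'', hrule, hdot, val_nextBinding hit'' _ e⟩

/-- An item with its dot not at the beginning is obtained from the state below. -/
theorem exists_unmoved {S : Γ.Stack} {ℓ : PLit Γ.arity (Option ℕ)} {it'' : Γ.Item ℕ}
    {e : Γ.Literal} (hit : it'' ∈ (Stack.top (N.push S ℓ e)).1) (hdot : it''.dot ≠ 0) :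
    ∃ it ∈ (Stack.top S).1, ∃ it', Moves ℓ it it' ∧ it''.rule = it.rule ∧
      it''.dot = it.dot + 1 ∧
      it''.val (Stack.top (N.push S ℓ e)).2 = it'.val (readBinding (Stack.top S).2 e) := by
  have hg := mem_target.1 hit
  generalize hr : it''.map _ = it' at hg
  cases hg with
  | call => exact absurd (congrArg Item.dot hr) hdot
  | base _ h =>
    obtain ⟨it, hit₀, hmv⟩ := h
    refine ⟨it, hit₀, it', hmv, ?_⟩
    obtain ⟨e₀, -, -, hrule, hdot, -⟩ := hmv
    rw [← hr] at hrule hdot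
    exact ⟨hrule, hdot, hr ▸ val_nextBinding hit _ e⟩

/-- The literals before the dot of an item of the topmost state are the topmost ones on the stack;
below them, the corresponding initial item occurs. -/
theorem Proper.exists_initial {S : Γ.Stack} (h : N.Proper S) : ∀ it ∈ (Stack.top S).1,
    ∃ F S', S = F ++ S' ∧
      (Stack.graph F).map (fun e => e.map some) =
        (it.rhs.take it.dot).map (fun e => e.map (it.val (Stack.top S).2)) ∧
      ∃ it₀ ∈ (Stack.top S').1, it₀.rule = it.rule ∧ it₀.dot = 0 ∧
        (∀ x y, it₀.val (Stack.top S').2 x = some y → it.val (Stack.top S).2 x = some y) ∧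
        ∀ x y, it₀.val (Stack.top S').2 x = none → it.val (Stack.top S).2 x = some y →
          y ∉ Graph.nodes (Stack.graph S') := by
  induction h with
  | nil =>
    intro it hit
    have hdot : it.dot = 0 := by
      cases hit with
      | base _ h =>
        cases h
        rfl
      | call => rfl
    exact ⟨[], [], rfl, by simp [hdot], it, hit, rfl, hdot, fun _ _ h => h, by simp⟩
  | push S ℓ e hS hℓ hm ih =>
    intro it₂ hit₂
    by_cases hdot : it₂.dot = 0
    · exact ⟨[], N.push S ℓ e, rfl, by simp [hdot], it₂, hit₂, rfl, hdot, fun _ _ h => h,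
        fun x y h h' => by cases h.symm.trans h'⟩
    obtain ⟨it, hit, it', hmv, hrule, hdot', hval⟩ := exists_unmoved hit₂ hdot
    obtain ⟨F, S', rfl, hF, it₀, hit₀, hrule₀, hdot₀, hold, hnew⟩ := ih it hit
    obtain ⟨e₀, he₀, -⟩ := id hmv
    obtain ⟨he, hext, hback⟩ := hmv.val he₀ hm
    have hrhs : it₂.rhs = it.rhs := by simp only [Item.rhs, hrule]
    -- `N.push` is a cons; its head is the new frame, to be put on top of `F`.
    refine ⟨(N.push (F ++ S') ℓ e).head (List.cons_ne_nil _ _) :: F, S', rfl, ?_, it₀, hit₀,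
      hrule₀.trans hrule.symm, hdot₀, fun x y h => ?_, fun x y h h' => ?_⟩
    · have hg : Stack.graph ((N.push (F ++ S') ℓ e).head (List.cons_ne_nil _ _) :: F) =
          Stack.graph F ++ [e] := by
        simp [Stack.graph]
        rfl
      have ht : it.rhs.take (it.dot + 1) = it.rhs.take it.dot ++ [e₀] := by
        rw [List.take_add_one, ← Item.next, he₀]
        rfl
      rw [hg, hrhs, hdot', ht, hval, List.map_append, List.map_append, hF]
      congr 1
      · refine List.map_congr_left fun a ha => Lit.map_congr fun x hx => ?_
        -- all nodes of literals before the dot have a value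
        have hmem : a.map (it.val (Stack.top (F ++ S')).2) ∈
            (Stack.graph F).map (fun e => e.map some) := by
          rw [hF]
          exact List.mem_map_of_mem ha
        obtain ⟨b, -, hb⟩ := List.mem_map.1 hmem
        obtain ⟨y, -, hy⟩ := Lit.exists_of_map_eq hb.symm hx
        rw [hy, hext x y hy]
      · simp [he]
    · rw [hval]
      exact hext x y (hold x y h)
    · rw [hval] at h'
      rcases hback x y h' with h' | ⟨-, -, -, hU⟩
      · exact hnew x y h h'
      · exact fun hy => hU (by simp [hy])

theorem AsrStep.isTrigger {t : Γ.Trigger} {c c' : Γ.AsrConf} (h : N.AsrStep t c c') :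
    IsTrigger (Stack.top c.1).1 t := by
  cases h <;> assumption

/-- The second half of the invariant survives a reduction because the nodes of the new literal are
values of the reduce item, hence nodes of the old stack. -/
theorem AsrStep.proper {t : Γ.Trigger} {c c' : Γ.AsrConf} (h : N.AsrStep t c c')
    (hc : N.Proper c.1 ∧ Graph.nodes (Stack.graph c.1) ⊆ Graph.nodes c.2) :
    N.Proper c'.1 ∧ Graph.nodes (Stack.graph c'.1) ⊆ Graph.nodes c'.2 := by
  obtain ⟨hP, hsub⟩ := hc
  cases h with
  | shift S g ℓ e ht hm =>
    refine ⟨.push S ℓ e hP ht.2 (hm.mono Set.subset_union_right), fun y hy => ?_⟩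
    simp only [graph_push, Graph.mem_nodes_append] at hy ⊢
    exact hy.imp_left fun h => hsub h
  | reduce F S g it r ht hr A ℓ hF hA hℓ hm =>
    refine ⟨.push S ℓ A hP.of_append hℓ hm, fun y hy => ?_⟩
    simp only [graph_push, Graph.mem_nodes_append, Graph.mem_nodes_cons, Graph.mem_nodes_nil,
      or_false] at hy
    rcases hy with hy | hy
    · exact hsub (by simp [hy])
    · obtain ⟨x, -, hx⟩ := Lit.exists_of_map_eq hA hy
      exact hsub (hP.val_mem hx.symm)

theorem AsrReach.proper {c c' : Γ.AsrConf} (h : N.AsrReach c c')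
    (hc : N.Proper c.1 ∧ Graph.nodes (Stack.graph c.1) ⊆ Graph.nodes c.2) :
    N.Proper c'.1 ∧ Graph.nodes (Stack.graph c'.1) ⊆ Graph.nodes c'.2 := by
  induction h with
  | refl => exact hc
  | tail _ h ih => exact h.choose_spec.proper ih

theorem AsrReached.proper {S : Γ.Stack} {g : Γ.Gr} (h : N.AsrReached S g) :
    N.Proper S ∧ Graph.nodes (Stack.graph S) ⊆ Graph.nodes g :=
  AsrReach.proper h ⟨.nil, by rfl⟩

theorem AsrReach.exists_append {c c' : Γ.AsrConf} (h : N.AsrReach c c') :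
    ∃ h, c'.2 = c.2 ++ h := by
  induction h with
  | refl => exact ⟨[], by simp⟩
  | tail _ h ih =>
    obtain ⟨h', ih⟩ := ih
    obtain ⟨t, h⟩ := h
    cases h with
    | shift S g ℓ e => exact ⟨h' ++ [e], by simp_all⟩
    | reduce => exact ⟨h', ih⟩

end Naming

/-! ### Soundness of the ASR parser -/

/-- Derivation steps use total renamings while items are only partially valued. A finite partial
injection of an infinite set extends to a permutation by cardinality. -/
theorem exists_embedding [Infinite X] {v : X → Option X} (hfin : {x | v x ≠ none}.Finite)
    (hinj : ∀ x x' y, v x = some y → v x' = some y → x = x') :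
    ∃ μ : X ↪ X, ∀ x y, v x = some y → μ x = y := by
  have hsome : ∀ x : {x | v x ≠ none}, ∃ y, v x = some y :=
    fun x => Option.ne_none_iff_exists'.1 x.2
  choose f hf using hsome
  have hlt : Cardinal.mk {x | v x ≠ none} < Cardinal.mk X :=
    (Cardinal.lt_aleph0_iff_set_finite.2 hfin).trans_le (Cardinal.aleph0_le_mk X)
  obtain ⟨π, hπ⟩ := Cardinal.extend_function_of_lt ⟨f, fun x x' h =>
    Subtype.ext (hinj _ _ _ (hf x) (h ▸ hf x'))⟩ hlt ⟨Equiv.refl X⟩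
  refine ⟨π.toEmbedding, fun x y hy => ?_⟩
  have h : v x ≠ none := by simp [hy]
  exact (hπ ⟨x, h⟩).trans (Option.some_injective _ ((hf ⟨x, h⟩).symm.trans hy))

theorem Graph.map_some_eq_iff {g g' : Γ.Gr} {v : X → Option X} {μ : X ↪ X}
    (h : ∀ x ∈ Graph.nodes g', v x = some (μ x)) :
    g.map (fun e => e.map some) = g'.map (fun e => e.map v) ↔
      g = g'.map fun e => e.rename μ := by
  induction g' generalizing g with
  | nil => simp
  | cons e' g' ih =>
    cases g with
    | nil => simp
    | cons e g =>
      simp only [List.map_cons, List.cons.injEq]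
      rw [Lit.map_some_eq_iff fun x hx => h x (by simp [hx]), ih fun x hx => h x (by simp [hx])]

theorem Graph.val_of_map_some_eq {g g' : Γ.Gr} {v : X → Option X}
    (h : g.map (fun e => e.map some) = g'.map (fun e => e.map v)) {x : X}
    (hx : x ∈ Graph.nodes g') : ∃ y ∈ Graph.nodes g, v x = some y := by
  obtain ⟨e', he', hx⟩ := hx
  obtain ⟨e, he, h⟩ := List.mem_map.1 (h.symm ▸ List.mem_map_of_mem he')
  obtain ⟨y, hy, hxy⟩ := Lit.exists_of_map_eq h.symm hx
  exact ⟨y, ⟨e, he, hy⟩, hxy⟩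

namespace Naming

variable {N : Naming Γ}

/-- A reduction is a reversed derivation step. A node outside the left-hand side has no value in the
initial item belonging to the stack below the handle, so its value was acquired later, from a node
not on that stack. -/
theorem Proper.reduce_derives [Infinite X] {F S : Γ.Stack} (hP : N.Proper (F ++ S))
    {it : Γ.Item ℕ} (hit : it ∈ (Stack.top (F ++ S)).1) (hred : it.IsReduce)
    {r : Rule Γ.arity X} (hr : it.rule = some r) {A : Γ.Literal}
    (hF : (Stack.graph F).map (fun e => e.map some) =
      r.rhs.map (fun e => e.map (it.val (Stack.top (F ++ S)).2)))
    (hA : A.map some = r.lhs.map (it.val (Stack.top (F ++ S)).2)) :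
    ∃ μ : X ↪ X, A = r.lhs.rename μ ∧ Stack.graph F = r.rhs.map (fun e => e.rename μ) ∧
      ∀ x ∈ Graph.nodes r.rhs, x ∉ r.lhs.nodes →
        μ x ∈ Graph.nodes (Stack.graph F) ∧ μ x ∉ Graph.nodes (Stack.graph S) := by
  have hreg := hP.regular hit
  obtain ⟨μ, hμ⟩ := exists_embedding (v := it.val (Stack.top (F ++ S)).2)
    (hreg.support.subset fun x hx hb => hx ((hP.val_eq_none_iff hit).2 hb))
    fun x x' y => hP.val_inj hit
  have hlhs : ∀ x ∈ r.lhs.nodes, it.val (Stack.top (F ++ S)).2 x = some (μ x) := by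
    intro x hx
    obtain ⟨y, -, hy⟩ := Lit.exists_of_map_eq hA.symm hx
    rw [hy, hμ x y hy]
  have hrhs : ∀ x ∈ Graph.nodes r.rhs, it.val (Stack.top (F ++ S)).2 x = some (μ x) := by
    intro x hx
    obtain ⟨y, -, hy⟩ := Graph.val_of_map_some_eq hF hx
    rw [hy, hμ x y hy]
  have hFμ := (Graph.map_some_eq_iff hrhs).1 hF
  refine ⟨μ, (Lit.map_some_eq_iff hlhs).1 hA, hFμ, fun x hx hx' => ⟨?_, ?_⟩⟩
  · rw [hFμ]
    exact Graph.mem_nodes_rename.2 ⟨x, hx, rfl⟩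
  · obtain ⟨F', S', hFS, hF', it₀, hit₀, hrule₀, hdot₀, -, hnew⟩ := hP.exists_initial it hit
    have hitr : it.rhs = r.rhs := by simp only [Item.rhs, hr]
    -- Both segments have the length of the right-hand side, so the split of the stack found by
    -- `exists_initial` is the one used by the reduction.
    have hlen : F.length = F'.length := by
      have h1 := congrArg List.length hF
      have h2 := congrArg List.length hF'
      rw [hred, List.take_length, hitr] at h2
      simp only [List.length_map, Stack.graph, List.length_reverse] at h1 h2
      omega
    obtain ⟨-, rfl⟩ := List.append_inj hFS hlen
    have hnone : it₀.bind x = none :=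
      (hP.of_append.regular hit₀).initial hdot₀ r (hrule₀.trans hr) x hx'
    exact hnew x _ ((hP.of_append.val_eq_none_iff hit₀).2 hnone) (hrhs x hx)

/-- Moving makes the dot positive and closure adds only items of genuine rules, so the initial item
of `Start → Z` lives in the bottom state alone. -/
theorem Proper.eq_nil {S : Γ.Stack} (h : N.Proper S) {it : Γ.Item ℕ}
    (hit : it ∈ (Stack.top S).1) (hr : it.rule = none) (hd : it.dot = 0) : S = [] := by
  cases h with
  | nil => rfl
  | push S ℓ e hS hℓ hm =>
    have hg := mem_target.1 hit
    generalize hi : it.map _ = it' at hg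
    cases hg with
    | base _ h =>
      obtain ⟨it₀, -, e₀, -, -, -, hdot, -⟩ := h
      rw [← hi] at hdot
      exact absurd (hd.symm.trans hdot) (by omega)
    | call => exact absurd ((congrArg Item.rule hi).symm.trans hr) (by simp)

theorem start_nodes (x : X) : x ∉ Γ.start.nodes := by
  rintro ⟨i, -⟩
  exact (Fin.cast Γ.start_arity i).elim0

theorem exists_final (N : Naming Γ) : ∃ it ∈ N.acceptState, it.rule = none ∧ it.dot = 1 := by
  obtain ⟨it', hmv⟩ := Moves.exists (it := (⟨none, 0, fun _ => none⟩ : Γ.Item ℕ))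
    (e := Γ.start) rfl
  obtain ⟨it, hit, hrule, hdot, -⟩ := exists_moved (N := N) (S := []) (.base _ rfl) hmv Γ.start
  exact ⟨it, hit, hrule, hdot⟩

theorem Proper.graph_of_accepting {S : Γ.Stack} (h : N.Proper S) (hacc : N.Accepting S) :
    Stack.graph S = [Γ.start] := by
  obtain ⟨it, hit, hrule, hdot⟩ := N.exists_final
  obtain ⟨F, S', rfl, hF, it₀, hit₀, hrule₀, hdot₀, -⟩ :=
    h.exists_initial it (by rwa [hacc])
  obtain rfl := h.of_append.eq_nil hit₀ (hrule₀.trans hrule) hdot₀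
  have hrhs : it.rhs = [Γ.start] := by simp only [Item.rhs, hrule]
  rw [hdot, hrhs] at hF
  simp only [List.append_nil] at hF ⊢
  obtain ⟨e, he, hmap⟩ := List.map_eq_cons_iff.1 hF
  obtain ⟨hge, hnil, hmap⟩ := hmap
  simp only [List.take_zero, List.map_nil, List.map_eq_nil_iff] at hmap
  rw [hge, hmap]
  congr 1
  refine Lit.map_some_injective (hnil.trans (Lit.map_congr fun x hx => ?_))
  exact absurd hx (start_nodes x)

/-- Backward induction from acceptance. The first conclusion, that unread literals meet the
processed graph only in nodes still on the stack, supplies the freshness relative to `h` that the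
derivation step of a reduction needs. -/
theorem AsrReach.sound [Infinite X] {c c' : Γ.AsrConf} (hreach : N.AsrReach c c')
    (hacc : N.Accepting c'.1) :
    N.Proper c.1 ∧ Graph.nodes (Stack.graph c.1) ⊆ Graph.nodes c.2 → ∀ h, c'.2 = c.2 ++ h →
      (∀ y ∈ Graph.nodes h, y ∈ Graph.nodes c.2 → y ∈ Graph.nodes (Stack.graph c.1)) ∧
      Relation.ReflTransGen Γ.Derives [Γ.start] (Stack.graph c.1 ++ h) := by
  induction hreach using Relation.ReflTransGen.head_induction_on with
  | refl =>
    intro hc h hh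
    obtain rfl : h = [] := by simpa using hh
    simp only [Graph.mem_nodes_nil, false_imp_iff, implies_true, true_and, List.append_nil]
    rw [hc.1.graph_of_accepting hacc]
  | head hstep hreach ih =>
    intro hc h hh
    obtain ⟨t, hstep⟩ := hstep
    have hc₁ := hstep.proper hc
    cases hstep with
    | shift S g ℓ e ht hm =>
      obtain ⟨h', hh'⟩ := AsrReach.exists_append hreach
      obtain rfl : h = e :: h' := by
        rw [hh] at hh'
        simpa using hh'
      obtain ⟨ih₁, ih₂⟩ := ih hc₁ h' hh'
      simp only [graph_push, List.append_assoc, List.singleton_append] at ih₂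
      refine ⟨fun y hy hyg => ?_, ih₂⟩
      have he : y ∈ e.nodes → y ∈ Graph.nodes (Stack.graph S) := by
        intro hye
        obtain ⟨φ, -, hφ⟩ := hm
        cases hb : φ y with
        | none => exact absurd (Or.inl hyg) ((hφ y hye).2 hb)
        | some p => exact hc.1.mem_of_bind ((hφ y hye).1 p hb)
      simp only [Graph.mem_nodes_cons, graph_push, Graph.mem_nodes_append, Graph.mem_nodes_nil,
        or_false] at hy ih₁
      rcases hy with hy | hy
      · exact he hy
      · exact (ih₁ y hy (.inl hyg)).elim id he
    | reduce F S g it r ht hr A ℓ hF hA hℓ hm =>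
      obtain ⟨ih₁, ih₂⟩ := ih hc₁ h hh
      obtain ⟨μ, rfl, hFμ, hfresh⟩ := hc.1.reduce_derives ht.1 ht.2 hr hF hA
      have hsub := hc.2
      simp only [graph_push, Graph.mem_nodes_append, Graph.mem_nodes_cons, Graph.mem_nodes_nil,
        or_false, Stack.graph_append] at ih₁ ⊢
      refine ⟨fun y hy hyg => (ih₁ y hy hyg).elim .inl fun hyA => ?_, ih₂.tail ?_⟩
      · obtain ⟨x, -, hx⟩ := Lit.exists_of_map_eq hA hyA
        simpa using hc.1.val_mem hx.symm
      · refine ⟨r, hc.1.regular ht.1 |>.rule_mem r hr, μ, Stack.graph S, h, ?_, ?_, ?_⟩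
        · simp [graph_push]
        · simp [hFμ]
        · intro x hx hx'
          obtain ⟨hxF, hxS⟩ := hfresh x hx hx'
          have hxA : μ x ∉ (r.lhs.rename μ).nodes := by
            rw [Lit.mem_nodes_rename]
            rintro ⟨x', hx'', h'⟩
            exact hx' (μ.injective h' ▸ hx'')
          simp only [graph_push, Graph.mem_nodes_append, Graph.mem_nodes_cons, Graph.mem_nodes_nil,
            or_false, not_or]
          refine ⟨⟨hxS, hxA⟩, fun hxh => ?_⟩
          -- The node was already processed, being on the popped stack; if it occurred in `h`, it
          -- would have to be on the stack after the reduction.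
          exact (ih₁ _ hxh (hsub (by simp [hxF]))).elim hxS hxA

end Naming

/-! ### Completeness of the ASR parser -/

variable (Γ) in
/-- `Generates U u w`: the terminal graph `w` is generated by the literals of `u` within a context
that contains the nodes of `U`. The nodes introduced by a rule occur neither in the context nor in
the parts of `w` generated by the other literals. -/
inductive Generates : Set X → Γ.Gr → Γ.Gr → Prop
  | nil (U : Set X) : Generates U [] []
  | read (U : Set X) (e : Γ.Literal) (u w : Γ.Gr) (he : e.sym ∈ Γ.terminal)
      (h : Generates (U ∪ e.nodes) u w) : Generates U (e :: u) (e :: w)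
  | call (U : Set X) (r : Rule Γ.arity X) (hr : r ∈ Γ.rules) (ν : X ↪ X) (u w₁ w₂ : Γ.Gr)
      (h₁ : Generates (U ∪ Graph.nodes w₂) (r.rhs.map fun e => e.rename ν) w₁)
      (h₂ : Generates (U ∪ Graph.nodes w₁) u w₂)
      (hnew : ∀ y ∈ Graph.nodes w₁, y ∈ U ∪ Graph.nodes w₂ → y ∈ (r.lhs.rename ν).nodes) :
      Generates U (r.lhs.rename ν :: u) (w₁ ++ w₂)

theorem Generates.mono {U U' : Set X} {u w : Γ.Gr} (h : Γ.Generates U u w) (hU : U' ⊆ U) :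
    Γ.Generates U' u w := by
  induction h generalizing U' with
  | nil => exact .nil _
  | read U e u w he h ih => exact .read _ e u w he (ih (Set.union_subset_union_left _ hU))
  | call U r hr ν u w₁ w₂ h₁ h₂ hnew ih₁ ih₂ =>
    exact .call _ r hr ν u w₁ w₂ (ih₁ (Set.union_subset_union_left _ hU))
      (ih₂ (Set.union_subset_union_left _ hU))
      fun y hy hy' => hnew y hy (Set.union_subset_union_left _ hU hy')

theorem Generates.mem_nodes {U : Set X} {u w : Γ.Gr} (h : Γ.Generates U u w) :
    ∀ y ∈ Graph.nodes w, y ∈ U → y ∈ Graph.nodes u := by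
  induction h with
  | nil => simp
  | read U e u w he h ih =>
    intro y hy hU
    rw [Graph.mem_nodes_cons] at hy ⊢
    exact hy.imp_right fun hy => ih y hy (.inl hU)
  | call U r hr ν u w₁ w₂ h₁ h₂ hnew ih₁ ih₂ =>
    intro y hy hU
    rw [Graph.mem_nodes_append] at hy
    rw [Graph.mem_nodes_cons]
    exact hy.imp (fun hy => hnew y hy (.inl hU)) fun hy => ih₂ y hy (.inl hU)

/-- Each part joins the context of the other, which records that nodes created in one part do not
occur in the other. `Generates.append` is the converse. -/
theorem Generates.split {a b : Γ.Gr} {U : Set X} {w : Γ.Gr} (h : Γ.Generates U (a ++ b) w) :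
    ∃ w₁ w₂, w = w₁ ++ w₂ ∧ Γ.Generates (U ∪ Graph.nodes w₂) a w₁ ∧
      Γ.Generates (U ∪ Graph.nodes w₁) b w₂ := by
  induction a generalizing U w with
  | nil => exact ⟨[], w, rfl, .nil _, h.mono fun y => by simp⟩
  | cons e a ih =>
    cases h with
    | read _ _ _ w he h =>
      obtain ⟨w₁, w₂, rfl, h₁, h₂⟩ := ih h
      refine ⟨e :: w₁, w₂, rfl, .read _ e a w₁ he (h₁.mono fun y => ?_), h₂.mono fun y => ?_⟩ <;>
      simp only [Set.mem_union, Graph.mem_nodes_cons] <;> tauto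
    | call _ r hr ν _ v w h₁ h₂ hnew =>
      obtain ⟨w₁, w₂, rfl, h₃, h₄⟩ := ih h₂
      refine ⟨v ++ w₁, w₂, by simp, .call _ r hr ν a v w₁ (h₁.mono fun y => ?_)
        (h₃.mono fun y => ?_) fun y hy hy' => hnew y hy ?_, h₄.mono fun y => ?_⟩ <;>
      simp only [Set.mem_union, Graph.mem_nodes_append] at * <;> tauto

theorem Generates.append {a b : Γ.Gr} {U : Set X} {w₁ w₂ : Γ.Gr}
    (ha : Γ.Generates (U ∪ Graph.nodes w₂) a w₁) (hb : Γ.Generates (U ∪ Graph.nodes w₁) b w₂) :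
    Γ.Generates U (a ++ b) (w₁ ++ w₂) := by
  induction a generalizing U w₁ with
  | nil =>
    cases ha
    exact hb.mono fun y hy => .inl hy
  | cons e a ih =>
    cases ha with
    | read _ _ _ w he h =>
      refine .read _ e _ _ he (ih (h.mono fun y => ?_) (hb.mono fun y => ?_)) <;>
      simp only [Set.mem_union, Graph.mem_nodes_cons] <;> tauto
    | call _ r hr ν _ v w h₁ h₂ hnew =>
      rw [List.append_assoc]
      refine .call _ r hr ν _ v _ (h₁.mono fun y => ?_)
        (ih (h₂.mono fun y => ?_) (hb.mono fun y => ?_)) fun y hy hy' => hnew y hy ?_ <;>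
      simp only [Set.mem_union, Graph.mem_nodes_append] at * <;> tauto

/-- Prepends a derivation step: the graph generated after the step is cut at the borders of the
right-hand side and reassembled around one `call`. -/
theorem Derives.generates {g g' w : Γ.Gr} (hd : Γ.Derives g g') (h : Γ.Generates ∅ g' w) :
    Γ.Generates ∅ g w := by
  obtain ⟨r, hr, ν, a, b, rfl, rfl, hfresh⟩ := hd
  rw [List.append_assoc] at h
  obtain ⟨w₁, w₂, rfl, h₁, h₂⟩ := h.split
  obtain ⟨v₁, v₂, rfl, h₃, h₄⟩ := h₂.split
  refine h₁.append (.call _ r hr ν b v₁ v₂ h₃ h₄ fun y hy hy' => ?_)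
  -- A node shared with the context stems from the right-hand side. Were it created by the step, it
  -- would be absent from `a` and `b`, hence, by `Generates.mem_nodes`, from what they generate.
  obtain ⟨x, hx, rfl⟩ := Graph.mem_nodes_rename.1 (h₃.mem_nodes y hy hy')
  by_contra hA
  have hx' := hfresh x hx fun hx' => hA (Lit.mem_nodes_rename.2 ⟨x, hx', rfl⟩)
  simp only [Graph.mem_nodes_append, Graph.mem_nodes_cons, not_or] at hx'
  rcases hy' with (hy' | hy') | hy'
  · exact hy'
  · exact hx'.1 (h₁.mem_nodes _ hy' (.inr (by simp [hy])))
  · exact hx'.2.2 (h₄.mem_nodes _ hy' (.inr hy))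

theorem IsTerminal.generates {h : Γ.Gr} (hh : Γ.IsTerminal h) (U : Set X) :
    Γ.Generates U h h := by
  induction h generalizing U with
  | nil => exact .nil U
  | cons e h ih =>
    exact .read U e h h (hh e (by simp)) (ih (fun e' he' => hh e' (by simp [he'])) _)

theorem generates_of_derives {g h : Γ.Gr} (hd : Relation.ReflTransGen Γ.Derives g h)
    (hh : Γ.IsTerminal h) : Γ.Generates ∅ g h := by
  induction hd using Relation.ReflTransGen.head_induction_on with
  | refl => exact hh.generates ∅
  | head hd _ ih => exact hd.generates ih

namespace Naming

variable {N : Naming Γ}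

/-- Here `μ` is the instantiation of the rule known from the derivation; the parser discovers it
node by node, and the valuation never deviates from it. -/
theorem Proper.read {S : Γ.Stack} (hS : N.Proper S) {it : Γ.Item ℕ}
    (hit : it ∈ (Stack.top S).1) {e₀ : Γ.Literal} (he₀ : it.next = some e₀) {μ : X ↪ X}
    (hμ : ∀ x y, it.val (Stack.top S).2 x = some y → y = μ x) {U : Set X}
    (hU : ∀ x ∈ e₀.nodes, it.val (Stack.top S).2 x = none → μ x ∉ U) :
    HasTransition (Stack.top S).1 (e₀.map it.bind) ∧
    Matches (Stack.top S).2 U (e₀.rename μ) (e₀.map it.bind) ∧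
    ∃ it' ∈ (Stack.top (N.push S (e₀.map it.bind) (e₀.rename μ))).1,
      it'.rule = it.rule ∧ it'.dot = it.dot + 1 ∧
      (∀ x y, it.val (Stack.top S).2 x = some y →
        it'.val (Stack.top (N.push S (e₀.map it.bind) (e₀.rename μ))).2 x = some y) ∧
      (∀ x ∈ e₀.nodes,
        it'.val (Stack.top (N.push S (e₀.map it.bind) (e₀.rename μ))).2 x = some (μ x)) ∧
      ∀ x y, it'.val (Stack.top (N.push S (e₀.map it.bind) (e₀.rename μ))).2 x = some y →
        y = μ x ∧ (it.val (Stack.top S).2 x = some y ∨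
          x ∈ e₀.nodes ∧ it.val (Stack.top S).2 x = none) := by
  obtain ⟨it₁, hmv⟩ := Moves.exists he₀
  have hm : Matches (Stack.top S).2 U (e₀.rename μ) (e₀.map it.bind) := by
    -- The labelling of input nodes is the assignment of the item transported along `μ`.
    refine ⟨Function.extend μ it.bind fun _ => none, ?_, ?_⟩
    · change e₀.map (fun x => Function.extend μ it.bind (fun _ => none) (μ x)) = _
      exact Lit.map_congr fun x _ => μ.injective.extend_apply _ _ x
    · intro y hy
      obtain ⟨x, hx, rfl⟩ := Lit.mem_nodes_rename.1 hy
      rw [μ.injective.extend_apply]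
      refine ⟨fun p hp => ?_, fun hb => hU x hx ((hS.val_eq_none_iff hit).2 hb)⟩
      obtain ⟨y, -, hτ⟩ := hS.bound p ⟨it, hit, x, hp⟩
      rw [hτ, hμ x y (by simp [Item.val, hp, hτ])]
  obtain ⟨it', hit', hrule, hdot, hval⟩ := exists_moved (N := N) hit hmv (e₀.rename μ)
  obtain ⟨h₁, h₂, h₃⟩ := hmv.val he₀ hm
  have h₁' : ∀ x ∈ e₀.nodes, it₁.val (readBinding (Stack.top S).2 (e₀.rename μ)) x = some (μ x) :=
    fun x hx => (Lit.eq_of_map_eq (f := fun x => some (μ x)) h₁ hx).symm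
  refine ⟨⟨it, hit, it₁, hmv⟩, hm, it', hit', hrule, hdot, ?_⟩
  rw [hval]
  refine ⟨h₂, h₁', fun x y hy => ?_⟩
  rcases h₃ x y hy with h | ⟨hx, hb, -, -⟩
  · exact ⟨hμ x y h, .inl h⟩
  · rw [h₁' x hx] at hy
    exact ⟨(Option.some_injective _ hy).symm, .inr ⟨hx, (hS.val_eq_none_iff hit).2 hb⟩⟩

theorem exists_call {S : Γ.Stack} {it : Γ.Item ℕ} (hit : it ∈ (Stack.top S).1)
    (hS : N.Proper S) {B : Γ.Literal} (hB : it.next = some B) {r : Rule Γ.arity X}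
    (hr : r ∈ Γ.rules) {μ ν : X ↪ X} (hBr : B.rename μ = r.lhs.rename ν) :
    ∃ it' ∈ (Stack.top S).1, it'.rule = some r ∧ it'.dot = 0 ∧
      ∀ x y, it'.val (Stack.top S).2 x = some y ↔
        x ∈ r.lhs.nodes ∧ ∃ x' ∈ B.nodes, μ x' = ν x ∧ it.val (Stack.top S).2 x' = some y := by
  classical
  obtain ⟨hs, hatt⟩ := Lit.map_eq_map_iff.1 (congrArg (fun e => Lit.map e id) hBr.symm)
  change ∀ i, ν (r.lhs.att i) = μ (B.att _) at hatt
  let β : X → Option ℕ := fun x =>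
    if h : x ∈ r.lhs.nodes then it.bind (B.att (Fin.cast (congrArg Γ.arity hs) h.choose)) else none
  have hβ : ∀ i, β (r.lhs.att i) = it.bind (B.att (Fin.cast (congrArg Γ.arity hs) i)) := by
    intro i
    have h : r.lhs.att i ∈ r.lhs.nodes := ⟨i, rfl⟩
    simp only [β, h, dite_true, r.lhs.att.injective h.choose_spec]
  have hβ' : ∀ x ∉ r.lhs.nodes, β x = none := fun x hx => by simp only [β, hx, dite_false]
  have hclosed : (⟨some r, 0, β⟩ : Γ.Item ℕ) ∈ (Stack.top S).1 := by
    have hpass : r.lhs.map β = B.map it.bind := Lit.map_eq_map_iff.2 ⟨hs, hβ⟩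
    cases hS with
    | nil => exact .call it hit B hB r hr β hpass hβ'
    | push S ℓ e =>
      rw [top_push] at hit ⊢
      -- Only the renamed target is a closure, so the called item is added there and carried back.
      refine mem_target.2 (.call _ (mem_target.1 hit) B hB r hr _ ?_ ?_)
      · exact Lit.map_comp_eq hpass (Option.map _)
      · exact fun x hx => by simp [hβ' x hx]
  refine ⟨_, hclosed, rfl, rfl, fun x y => ⟨fun h => ?_, ?_⟩⟩
  · have hx : x ∈ r.lhs.nodes := by
      by_contra hx
      simp [Item.val, hβ' x hx] at h
    obtain ⟨i, rfl⟩ := hx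
    simp only [Item.val, hβ] at h
    exact ⟨⟨i, rfl⟩, _, ⟨_, rfl⟩, (hatt i).symm, h⟩
  · rintro ⟨⟨i, rfl⟩, x', -, hx', h⟩
    rw [hatt i] at hx'
    obtain rfl := μ.injective hx'
    change (β _).bind _ = _
    rw [hβ]
    exact h

/-- Strengthened for induction to any item whose remaining right-hand side starts with the
generating literals, instantiated by `μ`. The last hypothesis says that already processed nodes of
`w` are known to the item; without it a node might be read at a placeholder although it is not new.
The last conclusion locates new values in `w`, so that the caller can re-establish that hypothesis.
-/
theorem Generates.parse (hbound : N.LhsBound) {U : Set X} {u w : Γ.Gr}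
    (h : Γ.Generates U u w) : ∀ (S : Γ.Stack) (g : Γ.Gr) (it : Γ.Item ℕ) (u₀ β : Γ.Gr) (μ : X ↪ X),
      N.Proper S ∧ Graph.nodes (Stack.graph S) ⊆ Graph.nodes g → Graph.nodes g ⊆ U →
      it ∈ (Stack.top S).1 → it.rhs.drop it.dot = u₀ ++ β → u = u₀.map (fun e => e.rename μ) →
      (∀ x y, it.val (Stack.top S).2 x = some y → y = μ x) →
      (∀ y ∈ Graph.nodes w, y ∈ Graph.nodes g →
        ∃ x, μ x = y ∧ it.val (Stack.top S).2 x = some y) →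
      ∃ F, N.AsrReach (S, g) (F ++ S, g ++ w) ∧ Stack.graph F = u ∧
        ∃ it' ∈ (Stack.top (F ++ S)).1, it'.rule = it.rule ∧ it'.dot = it.dot + u₀.length ∧
          (∀ x y, it.val (Stack.top S).2 x = some y →
            it'.val (Stack.top (F ++ S)).2 x = some y) ∧
          (∀ x ∈ Graph.nodes u₀, it'.val (Stack.top (F ++ S)).2 x = some (μ x)) ∧
          ∀ x y, it'.val (Stack.top (F ++ S)).2 x = some y →
            y = μ x ∧ (it.val (Stack.top S).2 x = some y ∨ y ∈ Graph.nodes w) := by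
  induction h with
  | nil U =>
    intro S g it u₀ β μ hS hg hit hdrop hu hμ hw
    obtain rfl : u₀ = [] := by simpa using hu.symm
    exact ⟨[], by simpa using .refl, rfl, it, hit, rfl, rfl, fun _ _ h => h, by simp,
      fun x y h => ⟨hμ x y h, .inl h⟩⟩
  | read U e u w he h ih =>
    intro S g it u₀ β μ hS hg hit hdrop hu hμ hw
    obtain ⟨e₀, u₀, rfl, rfl, rfl⟩ := List.map_eq_cons_iff.1 hu.symm
    have he₀ : it.next = some e₀ := by
      have := congrArg List.head? hdrop
      simpa [Item.next] using this
    have hfresh : ∀ x ∈ e₀.nodes, it.val (Stack.top S).2 x = none →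
        μ x ∉ Graph.nodes g ∪ Graph.nodes (Stack.graph S) := by
      intro x hx hv hU
      have hxg : μ x ∈ Graph.nodes g := hU.elim id fun h => hS.2 h
      obtain ⟨x', hx', hv'⟩ := hw (μ x)
        (Graph.mem_nodes_cons.2 (.inl (Lit.mem_nodes_rename.2 ⟨x, hx, rfl⟩))) hxg
      rw [μ.injective hx', hv] at hv'
      cases hv'
    obtain ⟨hℓ, hm, it', hit', hrule, hdot, hext, hnew, hback⟩ := hS.1.read hit he₀ hμ hfresh
    have hstep : N.AsrStep (.shift (e₀.map it.bind)) (S, g)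
        (N.push S (e₀.map it.bind) (e₀.rename μ), g ++ [e₀.rename μ]) :=
      .shift S g _ _ ⟨he, hℓ⟩ hm
    obtain ⟨F, hreach, hF, it'', hit'', hrule', hdot', hext', hnew', hback'⟩ :=
      ih _ (g ++ [e₀.rename μ]) it' u₀ β μ (hstep.proper hS) (fun y hy => by
        simp only [Graph.mem_nodes_append, Graph.mem_nodes_cons, Graph.mem_nodes_nil,
          or_false] at hy
        exact hy.imp_left fun h => hg h) hit' (by
        have := congrArg List.tail hdrop
        rw [List.tail_drop] at this
        simpa [Item.rhs, hrule, hdot] using this) rfl (fun x y h => (hback x y h).1) (by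
        intro y hy hyg
        simp only [Graph.mem_nodes_append, Graph.mem_nodes_cons, Graph.mem_nodes_nil,
          or_false] at hyg
        rcases hyg with hyg | hyg
        · obtain ⟨x, hx, hv⟩ := hw y (by simp [hy]) hyg
          exact ⟨x, hx, hext x y hv⟩
        · obtain ⟨x, hx, rfl⟩ := Lit.mem_nodes_rename.1 hyg
          exact ⟨x, rfl, hnew x hx⟩)
    obtain ⟨f, hpush⟩ : ∃ f, N.push S (e₀.map it.bind) (e₀.rename μ) = f :: S := ⟨_, rfl⟩
    have hgraph := graph_push (N := N) S (e₀.map it.bind) (e₀.rename μ)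
    have happ : F ++ N.push S (e₀.map it.bind) (e₀.rename μ) = (F ++ [f]) ++ S := by
      simp [hpush]
    have hf : Stack.graph [f] = [e₀.rename μ] := by
      rw [hpush] at hgraph
      exact List.append_cancel_left ((Stack.graph_append [f] S).symm.trans hgraph)
    rw [happ] at hreach hit'' hext' hnew' hback'
    refine ⟨F ++ [f], .head ⟨_, hstep⟩ (show N.AsrReach _ _ by simpa using hreach), ?_, it'', hit'',
      hrule'.trans hrule, ?_, fun x y h => hext' x y (hext x y h), ?_, ?_⟩
    · rw [Stack.graph_append, hf, hF]
      rfl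
    · rw [hdot', hdot, List.length_cons]
      omega
    · intro x hx
      rcases Graph.mem_nodes_cons.1 hx with hx | hx
      · exact hext' _ _ (hnew x hx)
      · exact hnew' x hx
    · intro x y h
      obtain ⟨hy, h⟩ := hback' x y h
      refine ⟨hy, ?_⟩
      rw [Graph.mem_nodes_cons]
      rcases h with h | h
      · rcases (hback x y h).2 with h | ⟨hx, -⟩
        · exact .inl h
        · exact .inr (.inl (Lit.mem_nodes_rename.2 ⟨x, hx, hy.symm⟩))
      · exact .inr (.inr h)
  | call U r hr ν u w₁ w₂ h₁ h₂ hfresh ih₁ ih₂ =>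
    intro S g it u₀ β μ hS hg hit hdrop hu hμ hw
    obtain ⟨e₀, u₀, rfl, heq, rfl⟩ := List.map_eq_cons_iff.1 hu.symm
    have he₀ : it.next = some e₀ := by
      have := congrArg List.head? hdrop
      simpa [Item.next] using this
    -- parse the part generated by the first literal
    obtain ⟨it₀, hit₀, hrule₀, hdot₀, hval₀⟩ := exists_call hit hS.1 he₀ hr heq
    have hold : ∀ y ∈ Graph.nodes w₁, y ∈ Graph.nodes g →
        ∃ x ∈ e₀.nodes, μ x = y ∧ it.val (Stack.top S).2 x = some y := by
      intro y hy hyg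
      obtain ⟨x, rfl, hv⟩ := hw y (by simp [hy]) hyg
      have := hfresh _ hy (.inl (hg hyg))
      rw [← heq] at this
      obtain ⟨x', hx', h'⟩ := Lit.mem_nodes_rename.1 this
      exact ⟨x, μ.injective h' ▸ hx', rfl, hv⟩
    obtain ⟨F₁, hreach₁, hF₁, it₁, hit₁, hrule₁, hdot₁, hext₁, hnew₁, hback₁⟩ :=
      ih₁ S g it₀ r.rhs [] ν hS (hg.trans Set.subset_union_left) hit₀
        (by simp [Item.rhs, hrule₀, hdot₀]) rfl (fun x y h => by
          obtain ⟨-, x', -, hx', h⟩ := (hval₀ x y).1 h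
          rw [hμ x' y h, hx']) (fun y hy hyg => by
          obtain ⟨x', hx', rfl, hv⟩ := hold y hy hyg
          have hmem : μ x' ∈ (r.lhs.rename ν).nodes :=
            heq ▸ Lit.mem_nodes_rename.2 ⟨x', hx', rfl⟩
          obtain ⟨x, hx, hxx'⟩ := Lit.mem_nodes_rename.1 hmem
          exact ⟨x, hxx', (hval₀ x _).2 ⟨hx, x', hx', hxx'.symm, hv⟩⟩)
    have hP₁ := AsrReach.proper hreach₁ hS
    rw [hrule₀] at hrule₁
    have hred : it₁.IsReduce := by simp [Item.IsReduce, hdot₁, hdot₀, Item.rhs, hrule₁]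
    -- all nodes of the left-hand side have got a value
    have hlhs : ∀ x ∈ r.lhs.nodes, it₁.val (Stack.top (F₁ ++ S)).2 x = some (ν x) := by
      intro x hx
      cases hv : it₁.val (Stack.top (F₁ ++ S)).2 x with
      | some y => rw [(hback₁ x y hv).1]
      | none =>
        have := hbound _ hP₁.1.isState it₁ hit₁ hred r hrule₁ x hx
        rw [(hP₁.1.val_eq_none_iff hit₁).1 hv] at this
        cases this
    -- A node of the literal unknown to the caller is unknown to the called item as well; as
    -- `LhsBound` gives it a value in the end, that value was read within `w₁`.
    have hmem₁ : ∀ x ∈ e₀.nodes, it.val (Stack.top S).2 x = none → μ x ∈ Graph.nodes w₁ := by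
      intro x hx hv
      have hmem : μ x ∈ (r.lhs.rename ν).nodes := heq ▸ Lit.mem_nodes_rename.2 ⟨x, hx, rfl⟩
      obtain ⟨x', hx', hxx'⟩ := Lit.mem_nodes_rename.1 hmem
      rw [← hxx']
      refine (hback₁ x' _ (hlhs x' hx')).2.resolve_left fun h => ?_
      obtain ⟨-, x'', -, hx'', h⟩ := (hval₀ _ _).1 h
      rw [μ.injective (hx''.trans hxx'), hv] at h
      cases h
    obtain ⟨hℓ, hm, it', hit', hrule, hdot, hext, hnew, hback⟩ := hS.1.read hit he₀ hμ
      (U := Graph.nodes (Stack.graph S)) (by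
      intro x hx hv hxS
      obtain ⟨x', -, hx', hv'⟩ := hold (μ x) (hmem₁ x hx hv) (hS.2 hxS)
      rw [μ.injective hx', hv] at hv'
      cases hv')
    have hstep : N.AsrStep (.reduce it₁) (F₁ ++ S, g ++ w₁)
        (N.push S (e₀.map it.bind) (e₀.rename μ), g ++ w₁) :=
      .reduce F₁ S _ it₁ r ⟨hit₁, hred⟩ hrule₁ _ _
        ((Graph.map_some_eq_iff hnew₁).2 hF₁)
        ((Lit.map_some_eq_iff hlhs).2 heq) hℓ hm
    obtain ⟨F, hreach, hF, it'', hit'', hrule', hdot', hext', hnew', hback'⟩ :=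
      ih₂ _ (g ++ w₁) it' u₀ β μ (hstep.proper hP₁) (fun y hy => by
        rw [Graph.mem_nodes_append] at hy
        exact hy.imp_left fun h => hg h) hit' (by
        have := congrArg List.tail hdrop
        rw [List.tail_drop] at this
        simpa [Item.rhs, hrule, hdot] using this) rfl (fun x y h => (hback x y h).1) (by
        intro y hy hyg
        by_cases hyg' : y ∈ Graph.nodes g
        · obtain ⟨x, hx, hv⟩ := hw y (by simp [hy]) hyg'
          exact ⟨x, hx, hext x y hv⟩
        · have hyw := (Graph.mem_nodes_append.1 hyg).resolve_left hyg'
          have := hfresh y hyw (.inr hy)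
          rw [← heq] at this
          obtain ⟨x, hx, rfl⟩ := Lit.mem_nodes_rename.1 this
          exact ⟨x, rfl, hnew x hx⟩)
    obtain ⟨f, hpush⟩ : ∃ f, N.push S (e₀.map it.bind) (e₀.rename μ) = f :: S := ⟨_, rfl⟩
    have hgraph := graph_push (N := N) S (e₀.map it.bind) (e₀.rename μ)
    have happ : F ++ N.push S (e₀.map it.bind) (e₀.rename μ) = (F ++ [f]) ++ S := by
      simp [hpush]
    have hf : Stack.graph [f] = [e₀.rename μ] := by
      rw [hpush] at hgraph
      exact List.append_cancel_left ((Stack.graph_append [f] S).symm.trans hgraph)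
    rw [happ] at hreach hit'' hext' hnew' hback'
    refine ⟨F ++ [f], hreach₁.trans (.head ⟨_, hstep⟩ (show N.AsrReach _ _ by simpa using hreach)),
      ?_, it'', hit'', hrule'.trans hrule, ?_, fun x y h => hext' x y (hext x y h), ?_, ?_⟩
    · rw [Stack.graph_append, hf, hF, heq]
      rfl
    · rw [hdot', hdot, List.length_cons]
      omega
    · intro x hx
      rcases Graph.mem_nodes_cons.1 hx with hx | hx
      · exact hext' _ _ (hnew x hx)
      · exact hnew' x hx
    · intro x y h
      obtain ⟨hy, h⟩ := hback' x y h
      refine ⟨hy, ?_⟩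
      rw [Graph.mem_nodes_append]
      rcases h with h | h
      · rcases (hback x y h).2 with h | ⟨hx, hv⟩
        · exact .inl h
        · exact .inr (.inl (hy ▸ hmem₁ x hx hv))
      · exact .inr (.inr h)

theorem Proper.accepting_of_graph {S : Γ.Stack} (h : N.Proper S)
    (hS : Stack.graph S = [Γ.start]) : N.Accepting S := by
  cases h with
  | nil => simp at hS
  | push S ℓ e _ hℓ hm =>
    rw [graph_push] at hS
    obtain ⟨hnil, he⟩ := List.append_inj' (s₂ := []) (t₂ := [Γ.start]) hS rfl
    obtain rfl : S = [] := by simpa [Stack.graph] using hnil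
    obtain rfl : e = Γ.start := by simpa using he
    obtain ⟨φ, rfl, -⟩ := hm
    have : Γ.start.map φ = Γ.start.map fun _ => none :=
      Lit.map_congr fun x hx => absurd hx (start_nodes x)
    rw [this]
    rfl

/-- Every valid graph can be processed in some order by the ASR parser. -/
theorem exists_asrReach_of_mem_language (hbound : N.LhsBound) {g : Γ.Gr} (hg : g ∈ Γ.language) :
    N.Completable [] [] g := by
  obtain ⟨hterm, h, hd, hperm⟩ := hg
  have hgen := generates_of_derives hd fun e he => hterm e (hperm.subset he)
  obtain ⟨F, hreach, hF, -⟩ := Generates.parse (N := N) hbound hgen [] [] ⟨none, 0, fun _ => none⟩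
    [Γ.start] [] (.refl X) ⟨.nil, by rfl⟩ (by rintro y ⟨e, he, -⟩; cases he) (.base _ rfl) rfl rfl
    (by simp [Item.val]) (by simp)
  rw [List.append_nil] at hreach
  have hP := (AsrReach.proper hreach ⟨.nil, by rfl⟩).1
  exact ⟨h, F, hperm, hreach, hP.accepting_of_graph hF⟩

end Naming

end HRGrammar

end HR

namespace HR

namespace HRGrammar

/-! ### Sequences of triggers -/

theorem exists_chain_of_transGen {α : Type} {R : α → α → Prop} {a b : α}
    (h : Relation.TransGen R a b) :
    ∃ (k : ℕ) (f : ℕ → α), f 0 = a ∧ f (k + 1) = b ∧ ∀ i ≤ k, R (f i) (f (i + 1)) := by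
  induction h with
  | @single b h =>
    refine ⟨0, fun i => if i = 0 then a else b, rfl, rfl, fun i hi => ?_⟩
    obtain rfl : i = 0 := by omega
    exact h
  | @tail b c _ h ih =>
    obtain ⟨k, f, h0, hk, hf⟩ := ih
    refine ⟨k + 1, fun i => if i ≤ k + 1 then f i else c, by simpa using h0, by simp,
      fun i hi => ?_⟩
    rcases Nat.lt_or_ge k i with hki | hki
    · obtain rfl : i = k + 1 := by omega
      simpa [hk] using h
    · simpa [hi, hki] using hf i hki

/-- Topological sorting: put a minimal element of the transitive closure first and recurse on the
others. -/
theorem exists_linear_extension {α : Type} {R : α → α → Prop}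
    (hR : ∀ a, ¬ Relation.TransGen R a a) {T : Set α} (hT : T.Finite) :
    ∃ l : List α, l.Nodup ∧ (∀ a, a ∈ l ↔ a ∈ T) ∧ l.Pairwise fun a b => ¬ R b a := by
  classical
  lift T to Finset α using hT
  induction T using Finset.strongInduction with
  | H T ih =>
    rcases T.eq_empty_or_nonempty with rfl | ⟨a, ha⟩
    · exact ⟨[], by simp⟩
    let r : T → T → Prop := fun a b => Relation.TransGen R a b
    have : IsTrans T r := ⟨fun _ _ _ h h' => Relation.TransGen.trans h h'⟩
    have : Std.Irrefl r := ⟨fun a => hR a⟩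
    obtain ⟨m, -, hm⟩ :=
      (Finite.wellFounded_of_trans_of_irrefl r).has_min Set.univ ⟨⟨a, ha⟩, trivial⟩
    obtain ⟨l, hnodup, hmem, hl⟩ := ih (T.erase m) (Finset.erase_ssubset m.2)
    refine ⟨m :: l, List.nodup_cons.2 ⟨by simp [hmem], hnodup⟩, fun b => ?_,
      List.pairwise_cons.2 ⟨fun b hb hbm => ?_, hl⟩⟩
    · simp only [List.mem_cons, hmem, Finset.coe_erase, Set.mem_sdiff, Set.mem_singleton_iff,
        Finset.mem_coe]
      by_cases hbm : b = m
      · simp [hbm]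
      · simp [hbm]
    · have hbT : b ∈ T := Finset.mem_of_mem_erase ((hmem b).1 hb)
      exact hm ⟨b, hbT⟩ trivial (.single hbm)

theorem exists_first {α : Type} {p : α → Prop} {l : List α} {a : α} (ha : a ∈ l) (hp : p a) :
    ∃ pre b post, l = pre ++ b :: post ∧ (∀ x ∈ pre, ¬ p x) ∧ p b := by
  induction l with
  | nil => cases ha
  | cons c l ih =>
    by_cases hc : p c
    · exact ⟨[], c, l, rfl, by simp, hc⟩
    · have hal : a ∈ l := (List.mem_cons.1 ha).resolve_left fun h => hc (h ▸ hp)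
      obtain ⟨pre, b, post, rfl, h, hb⟩ := ih hal
      exact ⟨c :: pre, b, post, rfl, by simpa [hc] using h, hb⟩

variable {X : Type} {Γ : HRGrammar X}

theorem IsTerminal.of_subset {g h : Γ.Gr} (hg : Γ.IsTerminal g) (hp : h ⊆ g) : Γ.IsTerminal h :=
  fun e he => hg e (hp he)

namespace Naming

variable {N : Naming Γ}

theorem IsState.exists_triggerSequence {Q : Γ.State ℕ} (hQ : N.IsState Q)
    (hconf : N.ConflictFree Q) : ∃ ts, N.IsTriggerSequence Q ts := by
  have hR : ∀ t, ¬ Relation.TransGen (N.Precedes Q) t t := by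
    intro t h
    obtain ⟨k, f, h0, hk, hf⟩ := exists_chain_of_transGen h
    have hprec : ∀ i : Fin (k + 1), N.Precedes Q (f i) (f (i + 1 : Fin (k + 1))) := by
      intro i
      have := hf i (by omega)
      -- At the last index the cyclic successor is `0`, and the chain closes up because `f (k + 1) =
      -- t = f 0`.
      rw [Fin.val_add_one]
      split_ifs with hi
      · rw [hi, Fin.val_last, hk, ← h0] at this
        rw [hi, Fin.val_last]
        exact this
      · exact this
    refine hconf (Set.range fun i : Fin (k + 1) => f i) ?_ ⟨k, fun i => f i, hprec, rfl⟩
    rintro _ ⟨i, rfl⟩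
    exact (hprec i).1
  obtain ⟨ts, hnodup, hmem, hts⟩ := exists_linear_extension hR hQ.finite_triggers
  refine ⟨ts, hnodup, hmem, ?_⟩
  -- `≺` is declared only between distinct triggers, so `Nodup` is needed to turn `¬ t' ≺ t` into
  -- disjointness.
  refine List.Pairwise.imp_of_mem ?_ (hnodup.and hts)
  rintro t t' ht ht' ⟨hne, h⟩
  by_contra hinter
  obtain ⟨o, ho, ho'⟩ := Set.nonempty_iff_ne_empty.2 hinter
  exact h ⟨(hmem _).1 ht', (hmem _).1 ht, Ne.symm hne, o, ho', ho⟩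

/-! ### Moves of the ASR parser are determined by their triggers -/

theorem AsrStep.shift_inv {ℓ : PLit Γ.arity (Option ℕ)} {c c' : Γ.AsrConf}
    (h : N.AsrStep (.shift ℓ) c c') : ∃ e, c' = (N.push c.1 ℓ e, c.2 ++ [e]) := by
  cases h with
  | shift S g ℓ e => exact ⟨e, rfl⟩

theorem AsrStep.reduce_inv {it : Γ.Item ℕ} {c c' : Γ.AsrConf} (h : N.AsrStep (.reduce it) c c') :
    ∃ F S r A ℓ, c.1 = F ++ S ∧ it.rule = some r ∧
      (Stack.graph F).map (fun e => e.map some) =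
        r.rhs.map (fun e => e.map (it.val (Stack.top c.1).2)) ∧
      A.map some = r.lhs.map (it.val (Stack.top c.1).2) ∧
      HasTransition (Stack.top S).1 ℓ ∧
      Matches (Stack.top S).2 (Graph.nodes (Stack.graph S)) A ℓ ∧ c' = (N.push S ℓ A, c.2) := by
  cases h with
  | reduce F S g it r ht hr A ℓ hF hA hℓ hm => exact ⟨F, S, r, A, ℓ, rfl, hr, hF, hA, hℓ, hm, rfl⟩

theorem mem_params_of_hasTransition {Q : Γ.State ℕ} {e : Γ.Literal} {φ : X → Option ℕ}
    (h : HasTransition Q (e.map φ)) {x : X} (hx : x ∈ e.nodes) {p : ℕ} (hp : φ x = some p) :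
    p ∈ params Q := by
  obtain ⟨it, hit, it', e₀, -, hℓ, -⟩ := h
  obtain ⟨x', -, hx'⟩ := Lit.exists_of_map_eq hℓ.symm hx
  exact ⟨it, hit, x', hx'.symm.trans hp⟩

/-- Whether a node is at a placeholder is decided by its absence from the stack, and otherwise
injectivity of the binding determines the parameter. -/
theorem Proper.transition_unique {S : Γ.Stack} (hS : N.Proper S) {A : Γ.Literal}
    {ℓ ℓ' : PLit Γ.arity (Option ℕ)} (hℓ : HasTransition (Stack.top S).1 ℓ)
    (hm : Matches (Stack.top S).2 (Graph.nodes (Stack.graph S)) A ℓ)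
    (hℓ' : HasTransition (Stack.top S).1 ℓ')
    (hm' : Matches (Stack.top S).2 (Graph.nodes (Stack.graph S)) A ℓ') : ℓ = ℓ' := by
  obtain ⟨φ, rfl, hφ⟩ := hm
  obtain ⟨φ', rfl, hφ'⟩ := hm'
  refine Lit.map_congr fun x hx => ?_
  obtain ⟨h₁, h₂⟩ := hφ x hx
  obtain ⟨h₁', h₂'⟩ := hφ' x hx
  cases hp : φ x with
  | none =>
    cases hp' : φ' x with
    | none => rfl
    | some p' => exact absurd (hS.mem_of_bind (h₁' p' hp')) (h₂ hp)
  | some p =>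
    cases hp' : φ' x with
    | none => exact absurd (hS.mem_of_bind (h₁ p hp)) (h₂' hp')
    | some p' =>
      rw [hS.inj p (mem_params_of_hasTransition hℓ hx hp) p'
        (mem_params_of_hasTransition hℓ' hx hp')
        ((h₁ p hp).trans (h₁' p' hp').symm)]

/-- The rule fixes the number of popped entries, the valuation fixes the pushed literal, and this
literal fixes the transition. A shift, in contrast, still has a choice of literal. -/
theorem AsrStep.reduce_unique {it : Γ.Item ℕ} {c c₁ c₂ : Γ.AsrConf} (hc : N.Proper c.1)
    (h₁ : N.AsrStep (.reduce it) c c₁) (h₂ : N.AsrStep (.reduce it) c c₂) : c₁ = c₂ := by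
  obtain ⟨F, S, r, A, ℓ, hFS, hr, hF, hA, hℓ, hm, rfl⟩ := h₁.reduce_inv
  obtain ⟨F', S', r', A', ℓ', hFS', hr', hF', hA', hℓ', hm', rfl⟩ := h₂.reduce_inv
  obtain rfl : r = r' := Option.some_injective _ (hr.symm.trans hr')
  obtain rfl := Lit.map_some_injective (hA.trans hA'.symm)
  have hlen := congrArg List.length (hF.trans hF'.symm)
  simp only [List.length_map, Stack.graph, List.length_reverse] at hlen
  obtain ⟨rfl, rfl⟩ := List.append_inj (hFS.symm.trans hFS') hlen
  rw [hFS] at hc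
  rw [hc.of_append.transition_unique hℓ hm hℓ' hm']

/-! ### Selection of triggers -/

theorem fits_nodeClass (Q : Γ.State ℕ) (τ : Binding X) (g : Γ.Gr) (e : Γ.Literal) :
    Fits Q τ e (e.map (nodeClass Q τ g)) := by
  refine ⟨_, rfl, fun x _ p _ h => ?_⟩
  unfold nodeClass at h
  split_ifs at h with h'
  cases h
  exact h'.choose_spec.2

variable {order : Γ.State ℕ → List Γ.Trigger}

/-- If the rest graph can be processed by a successful sequence caused by `t₀`, then the selection
succeeds and every return value consists of `t₀` and, if it is a literal, a useful one. -/
theorem selects_of_success {S : Γ.Stack} {g' rest h : Γ.Gr} {t₀ : Γ.Trigger}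
    (hseq : N.IsTriggerSequence (Stack.top S).1 (order (Stack.top S).1))
    (hfec : N.FreeEdgeChoice order) (hS : N.AsrReached S g') (hrest : Γ.IsTerminal rest)
    (ht₀ : IsTrigger (Stack.top S).1 t₀) (hh : h ∈ N.Success S g' t₀) (hperm : h.Perm rest) :
    (∃ t o, N.Selects order (Stack.top S).1 (Stack.top S).2 rest t o) ∧
    ∀ t o, N.Selects order (Stack.top S).1 (Stack.top S).2 rest t o →
      t = t₀ ∧ ∀ e, o = some e → N.Useful S g' rest t e := by
  have hhit : ∃ o, N.Hit (Stack.top S).1 (Stack.top S).2 rest t₀ o := by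
    cases h with
    | nil => exact ⟨none, hperm.nil_eq.symm, S, g', _, hS, rfl, [], hh, rfl⟩
    | cons e h =>
      exact ⟨some e, hperm.subset (by simp), _, ⟨S, g', _, hS, rfl, _, hh, rfl⟩,
        fits_nodeClass _ _ _ _⟩
  constructor
  · obtain ⟨pre, t, post, hord, hpre, o, ho⟩ :=
      exists_first (p := fun t => ∃ o, N.Hit (Stack.top S).1 (Stack.top S).2 rest t o)
        ((hseq.2.1 t₀).2 ht₀) hhit
    exact ⟨t, o, pre, post, hord, fun t' ht' o' ho' => hpre t' ht' ⟨o', ho'⟩, ho⟩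
  · intro t o hsel
    have huse : ∀ e, o = some e → N.Useful S g' rest t e := by
      rintro e rfl
      have hmem : e ∈ rest := by
        obtain ⟨-, -, -, -, he, -⟩ := hsel
        exact he
      have hne : rest ≠ [] := List.ne_nil_of_mem hmem
      refine hfec S g' rest hS hrest hne ?_ t e hsel
      rcases hh with ⟨rfl, -⟩ | ⟨c, SA, hstep, hreach, hacc⟩
      · exact absurd hperm.nil_eq.symm hne
      · exact ⟨h, SA, hperm, .head ⟨_, hstep⟩ hreach, hacc⟩
    refine ⟨?_, huse⟩
    -- The returned literal, or `$`, witnesses both sets: usefulness puts its class into `Follow` of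
    -- `t`, and its occurrence in `h` puts the same class into `FollowAny` of `t₀`.
    have hfollow : (N.Follow (Stack.top S).1 t ∩ N.FollowAny (Stack.top S).1 t₀).Nonempty := by
      obtain ⟨pre, post, -, -, ho⟩ := hsel
      cases o with
      | none =>
        obtain ⟨rfl, ho⟩ := ho
        exact ⟨none, ho, S, g', _, hS, rfl, h, hh, none, .inl ⟨hperm.eq_nil, rfl⟩, rfl⟩
      | some e =>
        exact ⟨_, (huse e rfl).1, S, g', _, hS, rfl, h, hh, some e,
          .inr ⟨e, hperm.symm.subset ho.1, rfl⟩, rfl⟩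
    obtain ⟨pre, post, hord, hpre, -⟩ := hsel
    have hmem := (hseq.2.1 t₀).2 ht₀
    have hpair := hseq.2.2
    rw [hord] at hmem hpair
    rcases List.mem_append.1 hmem with hmem | hmem
    · obtain ⟨o', ho'⟩ := hhit
      exact absurd ho' (hpre t₀ hmem o')
    rcases List.mem_cons.1 hmem with rfl | hmem
    · rfl
    · exact absurd ((List.pairwise_cons.1 (List.pairwise_append.1 hpair).2.1).1 t₀ hmem)
        hfollow.ne_empty

/-! ### PSR parsing -/

theorem PsrReach.asr {c c' : Γ.PsrConf} (h : N.PsrReach order c c') :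
    N.AsrReach (c.stack, c.read) (c'.stack, c'.read) ∧
      (c.read ++ c.rest).Perm (c'.read ++ c'.rest) := by
  induction h with
  | refl => exact ⟨.refl, .rfl⟩
  | tail _ h ih =>
    obtain ⟨t, o, -, -, hperm, hstep⟩ := h
    exact ⟨ih.1.tail ⟨t, hstep⟩, ih.2.trans hperm⟩

/-- Selection is forced to the trigger of a successful run. A reduction then coincides with that of
the run; for a shift, free edge choice provides a successful run that reads the selected literal. -/
theorem PsrMove.completable (hseq : ∀ Q, N.IsState Q → N.IsTriggerSequence Q (order Q))
    (hfec : N.FreeEdgeChoice order) {c c' : Γ.PsrConf} (hc : N.AsrReached c.stack c.read)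
    (hrest : Γ.IsTerminal c.rest) (h : N.Completable c.stack c.read c.rest)
    (hmove : N.PsrMove order c c') : N.Completable c'.stack c'.read c'.rest := by
  obtain ⟨h, SA, hperm, hreach, hacc⟩ := h
  obtain ⟨t, o, hsel, hread, hperm', hstep⟩ := hmove
  have hP := hc.proper.1
  have hseq' := hseq _ hP.isState
  obtain ⟨S, g, rest⟩ := c
  obtain ⟨S', g', rest'⟩ := c'
  dsimp only at *
  -- In an accepting configuration with empty `h`, the item of `Start → Z` would be selected, and it
  -- causes no move.
  rcases Relation.ReflTransGen.cases_head hreach with heq | ⟨c₁, ⟨t₀, hstep₀⟩, hreach₁⟩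
  · obtain ⟨rfl, hg⟩ := Prod.mk.inj heq
    obtain rfl : h = [] := by simpa using hg
    obtain ⟨it, hit, hrule, hdot⟩ := N.exists_final
    have htr : IsTrigger (Stack.top S).1 (.reduce it) := by
      refine ⟨by rwa [hacc], ?_⟩
      simp [Item.IsReduce, Item.rhs, hrule, hdot]
    obtain ⟨rfl, -⟩ := (selects_of_success hseq' hfec hc hrest htr
      (.inl ⟨rfl, hacc, htr, it, rfl, hrule⟩) hperm).2 t o hsel
    obtain ⟨_, _, _, _, _, _, hr, -⟩ := hstep.reduce_inv
    rw [hrule] at hr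
    cases hr
  · obtain ⟨rfl, huse⟩ := (selects_of_success hseq' hfec hc hrest hstep₀.isTrigger
      (.inr ⟨c₁, SA, hstep₀, hreach₁, hacc⟩) hperm).2 t o hsel
    cases t with
    | reduce it =>
      obtain rfl := hstep₀.reduce_unique hP hstep
      simp only [appended, List.append_nil] at hread
      subst hread
      exact ⟨h, SA, hperm.trans ((List.perm_append_left_iff _).1 hperm'), hreach₁, hacc⟩
    | shift ℓ =>
      obtain ⟨e, he⟩ := hstep.shift_inv
      simp only [Prod.mk.injEq] at he
      obtain ⟨rfl, rfl⟩ := he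
      have ho : o = some e := by
        have := List.append_cancel_left hread
        cases o <;> simp_all [appended]
      obtain ⟨e', rfl⟩ := hstep₀.shift_inv
      obtain ⟨h', hh'⟩ := AsrReach.exists_append hreach₁
      obtain rfl : h = e' :: h' := by simpa using hh'
      obtain ⟨h₂, hperm₂, S₂, SA₂, hstep₂, hreach₂, hacc₂⟩ :=
        (huse e ho).2 ⟨e', h', hperm, _, SA, hstep₀, hreach₁, hacc⟩
      obtain ⟨e₂, he₂⟩ := hstep₂.shift_inv
      simp only [Prod.mk.injEq, List.append_cancel_left_eq, List.cons.injEq, and_true] at he₂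
      obtain ⟨rfl, rfl⟩ := he₂
      refine ⟨h₂, SA₂, ?_, by simpa using hreach₂, hacc₂⟩
      rw [List.append_assoc] at hperm'
      exact (hperm₂.trans ((List.perm_append_left_iff _).1 hperm')).cons_inv

/-- A shift may replace the remaining ASR run by another one of unknown length, but it shortens the
rest graph; a reduction keeps the rest graph and follows the given run. Hence an outer induction on
the length of the rest graph and an inner one along the run. -/
theorem Completable.canAccept (hseq : ∀ Q, N.IsState Q → N.IsTriggerSequence Q (order Q))
    (hfec : N.FreeEdgeChoice order) {S : Γ.Stack} {g rest : Γ.Gr} (hc : N.AsrReached S g)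
    (hrest : Γ.IsTerminal rest) (h : N.Completable S g rest) :
    N.CanAccept order ⟨S, g, rest⟩ := by
  induction hn : rest.length using Nat.strong_induction_on generalizing S g rest with
  | _ n ih =>
    obtain ⟨h, SA, hperm, hreach, hacc⟩ := h
    suffices key : ∀ c cA : Γ.AsrConf, N.AsrReach c cA → N.Accepting cA.1 →
        N.AsrReached c.1 c.2 → cA.2 = c.2 ++ h → N.CanAccept order ⟨c.1, c.2, rest⟩ from
      key _ _ hreach hacc hc rfl
    clear hc hreach hacc S g SA
    intro c cA hreach hacc hc hh
    induction hreach using Relation.ReflTransGen.head_induction_on with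
    | refl =>
      obtain rfl : h = [] := by simpa using hh
      exact ⟨_, .refl, hperm.nil_eq.symm, hacc⟩
    | @head c c₁ hstep₀ hreach₁ ihr =>
      obtain ⟨t, hstep₀⟩ := hstep₀
      obtain ⟨S, g⟩ := c
      obtain ⟨SA, gA⟩ := cA
      obtain rfl : gA = g ++ h := hh
      obtain ⟨⟨t', o, hsel⟩, hall⟩ := selects_of_success (hseq _ hc.proper.1.isState) hfec hc hrest
        hstep₀.isTrigger (.inr ⟨c₁, SA, hstep₀, hreach₁, hacc⟩) hperm
      obtain ⟨rfl, huse⟩ := hall t' o hsel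
      have hnext : ∀ c₂ : Γ.PsrConf, N.PsrMove order ⟨S, g, rest⟩ c₂ →
          N.CanAccept order c₂ → N.CanAccept order ⟨S, g, rest⟩ :=
        fun c₂ hmove ⟨c', hreach, hacc⟩ => ⟨c', .head hmove hreach, hacc⟩
      cases t' with
      | reduce it =>
        obtain ⟨_, S', _, A, ℓ, _, -, -, -, -, -, rfl⟩ := hstep₀.reduce_inv
        refine hnext ⟨N.push S' ℓ A, g, rest⟩ ⟨_, o, hsel, by simp [appended], .rfl, hstep₀⟩ ?_
        exact ihr (hc.tail ⟨_, hstep₀⟩) rfl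
      | shift ℓ =>
        obtain ⟨e', rfl⟩ := hstep₀.shift_inv
        obtain ⟨h', hh'⟩ := AsrReach.exists_append hreach₁
        obtain rfl : h = e' :: h' := by simpa using hh'
        obtain ⟨e, rfl⟩ : ∃ e, o = some e := by
          cases o with
          | some e => exact ⟨e, rfl⟩
          | none =>
            obtain ⟨_, _, _, _, rfl, _⟩ := hsel
            simp at hperm
        obtain ⟨h₂, hperm₂, S₂, SA₂, hstep₂, hreach₂, hacc₂⟩ :=
          (huse e rfl).2 ⟨e', h', hperm, _, SA, hstep₀, hreach₁, hacc⟩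
        refine hnext ⟨S₂, g ++ [e], h₂⟩ ⟨_, some e, hsel, rfl, ?_, hstep₂⟩ ?_
        · rw [List.append_assoc]
          exact hperm₂.symm.append_left g
        · refine ih h₂.length ?_ (hc.tail ⟨_, hstep₂⟩)
            (hrest.of_subset fun e' he' => hperm₂.subset (by simp [he']))
            ⟨h₂, SA₂, .rfl, by simpa using hreach₂, hacc₂⟩ rfl
          rw [← hn, ← hperm₂.length_eq]
          simp

theorem PsrReach.completable (hseq : ∀ Q, N.IsState Q → N.IsTriggerSequence Q (order Q))
    (hfec : N.FreeEdgeChoice order) {g : Γ.Gr} (hg : Γ.IsTerminal g) (h : N.Completable [] [] g)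
    {c : Γ.PsrConf} (hc : N.PsrReach order ⟨[], [], g⟩ c) :
    N.Completable c.stack c.read c.rest := by
  induction hc with
  | refl => exact h
  | tail hreach hmove ih =>
    obtain ⟨hasr, hperm⟩ := PsrReach.asr hreach
    exact hmove.completable hseq hfec hasr
      (hg.of_subset fun e he => hperm.symm.subset (by simp [he])) ih

end Naming

end HRGrammar

end HR

theorem theoremt {X : Type} [Infinite X] (Γ : HR.HRGrammar X)
    (N : HR.HRGrammar.Naming Γ) (hbound : N.LhsBound)
    (hconf : ∀ Q, N.IsState Q → N.ConflictFree Q)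
    (order : Γ.State ℕ → List Γ.Trigger) (horder : N.IsTriggerOrder order)
    (hfec : N.FreeEdgeChoice order)
    (g : Γ.Gr) (hg : Γ.IsTerminal g) :
    (∀ c : Γ.PsrConf, N.PsrReach order ⟨[], [], g⟩ c →
      (N.CanAccept order c ↔ g ∈ Γ.language)) ∧
    (N.PsrAccepts order g ↔ g ∈ Γ.language) := by
  have hseq : ∀ Q, N.IsState Q → N.IsTriggerSequence Q (order Q) :=
    fun Q hQ => horder Q hQ (hQ.exists_triggerSequence (hconf Q hQ))
  have main : ∀ c : Γ.PsrConf, N.PsrReach order ⟨[], [], g⟩ c →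
      (N.CanAccept order c ↔ g ∈ Γ.language) := by
    intro c hc
    constructor
    · rintro ⟨c', hc', hrest, hacc⟩
      obtain ⟨hasr, hperm⟩ := HR.HRGrammar.Naming.PsrReach.asr (hc.trans hc')
      -- From the initial configuration the stack is empty, so soundness derives exactly the graph
      -- that was read; as nothing is left to read, it is a permutation of `g`.
      have hd := (hasr.sound hacc ⟨.nil, by rfl⟩ c'.read rfl).2
      simp only [hrest, List.nil_append, List.append_nil] at hperm
      exact ⟨hg, c'.read, hd, hperm.symm⟩
    · intro hlang
      obtain ⟨hasr, hperm⟩ := HR.HRGrammar.Naming.PsrReach.asr hc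
      have hcomp := HR.HRGrammar.Naming.exists_asrReach_of_mem_language hbound hlang
      exact (hc.completable hseq hfec hg hcomp).canAccept hseq hfec hasr
        (hg.of_subset fun e he => hperm.symm.subset (by simp [he]))
  exact ⟨main, main _ .refl⟩
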